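/- Let $k$ be a field of characteristic zero, let $S = k[x]$, let $0 \neq h \in S$, and let $A_h = k\langle x, y\rangle/(yx - xy - h)$. Let $d = \gcd(h, h')$, where $h'$ is the derivative of $h$, and let $I$ be the ideal of $S/(h)$ generated by the class of $h/d$. For a $k$-algebra $A$ with enveloping algebra $A^e = A \otimes_k A^{\mathrm{op}}$, let $HH^i(A) = \mathrm{Ext}^i_{A^e}(A, A)$ denote its Hochschild cohomology. Then there are isomorphisms of $k$-vector spaces $$HH^0(A_h) \cong k, \qquad HH^1(A_h) \cong S/(h) \oplus I[y], \qquad HH^2(A_h) \cong \bigl(S/(d)\bigr)[y],$$ and $HH^i(A_h) = 0$ for all $i \geq 3$. Here $I[y]$ is the space of polynomials in the variable $y$ over $S/(h)$ all of whose coefficients lie in $I$, and $(S/(d))[y]$ is the space of polynomials in $y$ with coefficients in $S/(d)$. -/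

import Mathlib

open Polynomial CategoryTheory
open scoped TensorProduct MulOpposite

universe u

/-- The enveloping algebra `A ⊗ Aᵐᵒᵖ` of a `k`-algebra `A`, whose left modules are the
`A`-bimodules. -/
abbrev EnvelopingAlgebra (k A : Type u) [Field k] [Ring A] [Algebra k A] : Type u :=
  A ⊗[k] Aᵐᵒᵖ

/-- `A` as a module over its enveloping algebra. -/
noncomputable def regularBimodule (k A : Type u) [Field k] [Ring A] [Algebra k A] :
    ModuleCat.{u} (EnvelopingAlgebra k A) :=
  letI : Module (EnvelopingAlgebra k A) A := TensorProduct.Algebra.module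
  ModuleCat.of (EnvelopingAlgebra k A) A

/-- The action on the regular bimodule is `(a ⊗ b) • m = a * m * b`. -/
theorem regularBimodule_smul (k A : Type u) [Field k] [Ring A] [Algebra k A] (a b m : A) :
    ((a ⊗ₜ[k] MulOpposite.op b : EnvelopingAlgebra k A) • (show regularBimodule k A from m) :
      regularBimodule k A) = (show regularBimodule k A from a * m * b) := by
  let : Module (EnvelopingAlgebra k A) A := TensorProduct.Algebra.module
  change (a ⊗ₜ[k] MulOpposite.op b : EnvelopingAlgebra k A) • m = a * m * b
  rw [TensorProduct.Algebra.smul_def]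
  simp [mul_assoc]

/-- Hochschild cohomology `HHⁱ(A) = Extⁱ(A, A)` over the enveloping algebra of `A`, as a
`k`-vector space. -/
noncomputable abbrev HochschildCohomology (k A : Type u) [Field k] [Ring A] [Algebra k A]
    (i : ℕ) : ModuleCat.{u} k :=
  ((Ext k (ModuleCat.{u} (EnvelopingAlgebra k A)) i).obj
    (Opposite.op (regularBimodule k A))).obj (regularBimodule k A)

/-- The defining relation `yx - xy - h = 0`, where the generator `0` is `x` and the generator
`1` is `y`. -/
def AhRel {k : Type u} [Field k] (h : k[X]) (a b : FreeAlgebra k (Fin 2)) : Prop :=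
  a = FreeAlgebra.ι k 1 * FreeAlgebra.ι k 0 - FreeAlgebra.ι k 0 * FreeAlgebra.ι k 1
    - aeval (FreeAlgebra.ι k (0 : Fin 2)) h ∧ b = 0

/-- The algebra `A_h = k⟨x, y⟩ / (yx - xy - h)`. -/
abbrev Ah {k : Type u} [Field k] (h : k[X]) : Type u :=
  RingQuot (AhRel h)

/-- A greatest common divisor of `h` and its derivative. -/
noncomputable def gcdDeriv {k : Type u} [Field k] (h : k[X]) : k[X] :=
  letI := Classical.decEq k[X]
  EuclideanDomain.gcd h (derivative h)

/-- The ideal of `k[x]/(h)` generated by the class of `h/d`, where `d = gcd(h, h')`. -/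
noncomputable def idealI {k : Type u} [Field k] (h : k[X]) : Ideal (k[X] ⧸ Ideal.span {h}) :=
  Ideal.span {Ideal.Quotient.mk (Ideal.span {h}) (h / gcdDeriv h)}

/-- The space `I[y]` of polynomials in `y` all of whose coefficients lie in the ideal `I`. -/
def polynomialsIn (k : Type u) {R : Type u} [Field k] [CommRing R] [Algebra k R] (I : Ideal R) :
    Submodule k R[X] where
  carrier := {p | ∀ n, p.coeff n ∈ I}
  zero_mem' n := by simp
  add_mem' hp hq n := by
    rw [coeff_add]
    exact I.add_mem (hp n) (hq n)
  smul_mem' c p hp n := by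
    rw [coeff_smul, Algebra.smul_def]
    exact I.mul_mem_left _ (hp n)

/-! Write `A` for `A_h` and let `∂h` be the noncommutative divided difference of `h`, sending `u` to
`∑ x^i u x^(n-1-i)` when `h = x^n`. Differentiating the single relation `yx - xy - h` gives a free
bimodule resolution `0 → Aᵉ → Aᵉ × Aᵉ → Aᵉ → A → 0` (`exact_diff₁_augmentation`,
`exact_diff₂_diff₁`, `diff₂_injective`). Hence Ext vanishes from degree 3 on, and the rest is the
cohomology of `A → A × A → A` with maps `a ↦ ([x,a], [y,a])` and `(u,v) ↦ [y,u] - ∂h·u + [v,x]`.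

Three facts about `A`, which has basis `x^i y^j`, settle it. In characteristic zero `[A,x] = hA`
(`exists_commutator_eq`), and the centralizer of `x` is `k[x]` (`exists_eq_aeval_of_commute`), both
because `[y^(n+1),x]` is `h` times an element with leading term `(n+1)y^n`. For `d ∣ h`, the
quotient `A/dA` is the commutative ring `(S/(d))[y]` (`reduction`), where commutators die and `∂h·u`
becomes `h'u`.

Degree 0: a central element is some `f(x)` with `[y,f] = hf' = 0`, hence a constant. Degree 2: the
image of the last map contains `hA` and is `h'·A` modulo `hA`, so it is `dA`. Degree 1: the first
component `u` of a cocycle satisfies `h'u = 0` modulo `hA`, that is, its class lies in `I[y]`, and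
every such `u` occurs. If `u ∈ hA = [A,x]`, a coboundary reduces the cocycle to `(0, f(x))`, and
this is a coboundary exactly when `f = hg'` for some `g`, that is, when `h ∣ f`; this contributes
`S/(h)`. -/

/-! ### Projective resolutions of length two. -/

section LengthTwo

open Limits ZeroObject

universe v w

variable {C : Type w} [Category.{v} C] [Abelian C]

/-- The objects of a chain complex of length two. -/
noncomputable def lengthTwoX (X₀ X₁ X₂ : C) : ℕ → C
  | 0 => X₀
  | 1 => X₁
  | 2 => X₂
  | _ + 3 => 0

/-- The differentials of a chain complex of length two. -/
noncomputable def lengthTwoD {X₀ X₁ X₂ : C} (d₁ : X₁ ⟶ X₀) (d₂ : X₂ ⟶ X₁) :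
    ∀ m n, lengthTwoX X₀ X₁ X₂ m ⟶ lengthTwoX X₀ X₁ X₂ n
  | 1, 0 => d₁
  | 2, 1 => d₂
  | 0, _ => 0
  | 1, _ + 1 => 0
  | 2, 0 => 0
  | 2, _ + 2 => 0
  | _ + 3, _ => 0

/-- The chain complex `⋯ ⟶ 0 ⟶ X₂ ⟶ X₁ ⟶ X₀`. -/
noncomputable def lengthTwoComplex {X₀ X₁ X₂ : C} (d₁ : X₁ ⟶ X₀) (d₂ : X₂ ⟶ X₁)
    (w : d₂ ≫ d₁ = 0) : ChainComplex C ℕ where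
  X := lengthTwoX X₀ X₁ X₂
  d := lengthTwoD d₁ d₂
  shape
    | 1, 0, h => (h rfl).elim
    | 2, 1, h => (h rfl).elim
    | 0, _, _ => rfl
    | 1, _ + 1, _ => rfl
    | 2, 0, _ => rfl
    | 2, _ + 2, _ => rfl
    | _ + 3, _, _ => rfl
  d_comp_d' := by
    rintro i j l hij hjl
    obtain rfl : j + 1 = i := hij
    obtain rfl : l + 1 = j := hjl
    rcases l with _ | l
    · exact w
    · exact zero_comp

variable {X₀ X₁ X₂ Z : C} (d₁ : X₁ ⟶ X₀) (d₂ : X₂ ⟶ X₁) (w : d₂ ≫ d₁ = 0)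

lemma isZero_lengthTwoComplex_X (n : ℕ) : IsZero ((lengthTwoComplex d₁ d₂ w).X (n + 3)) :=
  isZero_zero C

lemma lengthTwoComplex_exactAt_succ [Mono d₂] (hex : (ShortComplex.mk d₂ d₁ w).Exact) (n : ℕ) :
    (lengthTwoComplex d₁ d₂ w).ExactAt (n + 1) := by
  rw [HomologicalComplex.exactAt_iff' _ (n + 2) (n + 1) n (by simp) (by simp)]
  rcases n with _ | _ | n
  · exact hex
  · have : Mono ((lengthTwoComplex d₁ d₂ w).sc' (0 + 1 + 2) (0 + 1 + 1) (0 + 1)).g :=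
      ‹Mono d₂›
    exact (ShortComplex.exact_iff_mono _ rfl).2 this
  · exact ShortComplex.exact_of_isZero_X₂ _ (isZero_lengthTwoComplex_X d₁ d₂ w n)

/-- The projective resolution given by an exact sequence `0 ⟶ X₂ ⟶ X₁ ⟶ X₀ ⟶ Z ⟶ 0` with
projective `X₀`, `X₁`, `X₂`. -/
noncomputable def lengthTwoResolution [Projective X₀] [Projective X₁] [Projective X₂] [Mono d₂]
    (ε : X₀ ⟶ Z) [Epi ε] (w' : d₁ ≫ ε = 0) (hex : (ShortComplex.mk d₂ d₁ w).Exact)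
    (hex' : (ShortComplex.mk d₁ ε w').Exact) : ProjectiveResolution Z where
  complex := lengthTwoComplex d₁ d₂ w
  projective
    | 0 => ‹Projective X₀›
    | 1 => ‹Projective X₁›
    | 2 => ‹Projective X₂›
    | n + 3 => (isZero_lengthTwoComplex_X d₁ d₂ w n).projective
  π := (ChainComplex.toSingle₀Equiv _ _).symm ⟨ε, w'⟩
  quasiIso := ⟨fun n => by
    cases n
    · rw [ChainComplex.quasiIsoAt₀_iff, ShortComplex.quasiIso_iff_of_zeros']
      · have hε := ChainComplex.toSingle₀Equiv_symm_apply_f_zero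
          (C := lengthTwoComplex d₁ d₂ w) ε w'
        refine (ShortComplex.exact_and_epi_g_iff_of_iso ?_).2 ⟨hex', by dsimp; infer_instance⟩
        refine ShortComplex.isoMk (Iso.refl _) (Iso.refl _) (Iso.refl _) ?_ ?_
        · exact (Category.id_comp _).trans (Category.comp_id _).symm
        · exact (Category.id_comp _).trans (hε.symm.trans (Category.comp_id _).symm)
      all_goals rfl
    · rw [quasiIsoAt_iff_exactAt']
      · exact lengthTwoComplex_exactAt_succ d₁ d₂ w hex _
      · apply ChainComplex.exactAt_succ_single_obj⟩

end LengthTwo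

/-! ### Ext read off from a resolution of length two. -/

section Homology

universe v w

/-- Lets homology be computed in coordinates: `N` plays the cocycles, and `φ` is a surjection from
them whose kernel is the coboundaries. -/
lemma nonempty_homology_linearEquiv {k : Type v} [Ring k] (S : ShortComplex (ModuleCat.{w} k))
    {M H : Type*} [AddCommGroup M] [Module k M] [AddCommGroup H] [Module k H]
    (e : S.X₂ ≃ₗ[k] M) (N : Submodule k M) (hN : ∀ z, e z ∈ N ↔ S.g.hom z = 0)
    (φ : N →ₗ[k] H) (hφ : Function.Surjective φ)
    (hker : ∀ z, φ z = 0 ↔ ∃ y, S.f.hom y = e.symm z) :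
    Nonempty (S.homology ≃ₗ[k] H) := by
  have hN' : LinearMap.ker S.g.hom = N.comap e.toLinearMap := by
    ext z
    exact (hN z).symm
  let e' : LinearMap.ker S.g.hom ≃ₗ[k] N :=
    LinearEquiv.ofEq _ _ hN' ≪≫ₗ e.ofSubmodule' N
  refine ⟨S.moduleCatHomologyIso.toLinearEquiv ≪≫ₗ
    Submodule.quotEquivOfEq _ _ ?_ ≪≫ₗ
      (φ ∘ₗ e'.toLinearMap).quotKerEquivOfSurjective (hφ.comp e'.surjective)⟩
  ext z
  rw [LinearMap.mem_ker]
  refine Iff.trans ?_ (hker (e' z)).symm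
  have : e.symm (e' z) = z := e.symm_apply_apply _
  rw [this]
  constructor
  · rintro ⟨a, rfl⟩
    exact ⟨a, rfl⟩
  · rintro ⟨a, ha⟩
    exact ⟨a, Subtype.ext ha⟩

end Homology

section Ext

open Limits
universe v w
variable {k : Type v} [Ring k] {C : Type w} [Category.{v} C] [Abelian C] [Linear k C]
  [EnoughProjectives C]
variable {X₀ X₁ X₂ Z : C} [Projective X₀] [Projective X₁] [Projective X₂]
  {d₁ : X₁ ⟶ X₀} {d₂ : X₂ ⟶ X₁} (w : d₂ ≫ d₁ = 0) [Mono d₂]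
  (ε : X₀ ⟶ Z) [Epi ε] (w' : d₁ ≫ ε = 0)
  {M H : Type*} [AddCommGroup M] [Module k M] [AddCommGroup H] [Module k H]

lemma nonempty_ext_zero_linearEquiv (hex : (ShortComplex.mk d₂ d₁ w).Exact)
    (hex' : (ShortComplex.mk d₁ ε w').Exact) (Y : C)
    (e : (X₀ ⟶ Y) ≃ₗ[k] M) (N : Submodule k M)
    (hN : ∀ z, e z ∈ N ↔ d₁ ≫ z = 0) (φ : N ≃ₗ[k] H) :
    Nonempty (((Ext k C 0).obj (Opposite.op Z)).obj Y ≃ₗ[k] H) := by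
  let P := lengthTwoResolution d₁ d₂ w ε w' hex hex'
  let K := P.complex.linearYonedaObj k Y
  -- Nothing precedes degree 0, so the predecessor index of 0 is 0 itself and the incoming map `d 0
  -- 0` vanishes.
  let i := P.isoExt (R := k) 0 Y ≪≫ K.homologyIsoSc' 0 0 1 (by simp) (by simp)
  obtain ⟨j⟩ := nonempty_homology_linearEquiv (K.sc' 0 0 1) e N hN φ.toLinearMap φ.surjective
    fun z => by
      refine (φ.map_eq_zero_iff).trans ⟨?_, ?_⟩
      · rintro rfl
        exact ⟨0, (map_zero _).trans (map_zero e.symm).symm⟩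
      · rintro ⟨y, hy⟩
        have : e.symm z = 0 := hy.symm.trans (zero_comp (f := (y : X₀ ⟶ Y)))
        exact Subtype.ext (e.symm.map_eq_zero_iff.1 this)
  exact ⟨i.toLinearEquiv ≪≫ₗ j⟩

lemma nonempty_ext_one_linearEquiv (hex : (ShortComplex.mk d₂ d₁ w).Exact)
    (hex' : (ShortComplex.mk d₁ ε w').Exact) (Y : C)
    (e : (X₁ ⟶ Y) ≃ₗ[k] M) (N : Submodule k M)
    (hN : ∀ z, e z ∈ N ↔ d₂ ≫ z = 0) (φ : N →ₗ[k] H) (hφ : Function.Surjective φ)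
    (hker : ∀ z : N, φ z = 0 ↔ ∃ y, d₁ ≫ y = e.symm z) :
    Nonempty (((Ext k C 1).obj (Opposite.op Z)).obj Y ≃ₗ[k] H) := by
  let P := lengthTwoResolution d₁ d₂ w ε w' hex hex'
  let K := P.complex.linearYonedaObj k Y
  let i := P.isoExt (R := k) 1 Y ≪≫ K.homologyIsoSc' 0 1 2 (by simp) (by simp)
  obtain ⟨j⟩ := nonempty_homology_linearEquiv (K.sc' 0 1 2) e N hN φ hφ hker
  exact ⟨i.toLinearEquiv ≪≫ₗ j⟩

lemma nonempty_ext_two_linearEquiv (hex : (ShortComplex.mk d₂ d₁ w).Exact)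
    (hex' : (ShortComplex.mk d₁ ε w').Exact) (Y : C)
    (e : (X₂ ⟶ Y) ≃ₗ[k] M) (φ : M →ₗ[k] H)
    (hφ : Function.Surjective φ) (hker : ∀ z, φ z = 0 ↔ ∃ y, d₂ ≫ y = e.symm z) :
    Nonempty (((Ext k C 2).obj (Opposite.op Z)).obj Y ≃ₗ[k] H) := by
  let P := lengthTwoResolution d₁ d₂ w ε w' hex hex'
  let K := P.complex.linearYonedaObj k Y
  let i := P.isoExt (R := k) 2 Y ≪≫ K.homologyIsoSc' 1 2 3 (by simp) (by simp)
  obtain ⟨j⟩ := nonempty_homology_linearEquiv (K.sc' 1 2 3) e ⊤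
    (fun z => ⟨fun _ => zero_comp (f := (z : X₂ ⟶ Y)), fun _ => trivial⟩)
    (φ ∘ₗ Submodule.subtype ⊤)
    (fun x => let ⟨m, hm⟩ := hφ x; ⟨⟨m, trivial⟩, hm⟩) (fun z => hker z)
  exact ⟨i.toLinearEquiv ≪≫ₗ j⟩

lemma subsingleton_ext_of_three_le (hex : (ShortComplex.mk d₂ d₁ w).Exact)
    (hex' : (ShortComplex.mk d₁ ε w').Exact) (Y : C)
    {n : ℕ} (hn : 3 ≤ n) :
    Subsingleton (((Ext k C n).obj (Opposite.op Z)).obj Y) := by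
  obtain ⟨m, rfl⟩ := Nat.exists_eq_add_of_le' hn
  let P := lengthTwoResolution d₁ d₂ w ε w' hex hex'
  apply ModuleCat.subsingleton_of_isZero
  refine IsZero.of_iso ?_ (P.isoExt (R := k) (m + 3) Y)
  rw [← HomologicalComplex.exactAt_iff_isZero_homology, HomologicalComplex.exactAt_iff]
  refine ShortComplex.exact_of_isZero_X₂ _ ?_
  rw [IsZero.iff_id_eq_zero]
  ext (x : _ ⟶ _)
  obtain rfl : x = 0 := (isZero_lengthTwoComplex_X d₁ d₂ w m).eq_of_src _ _
  rfl

end Ext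

/-! ### Noncommutative divided differences. -/

theorem Polynomial.induction_X_mul {k : Type*} [Semiring k] {P : k[X] → Prop} (f : k[X])
    (hC : ∀ c, P (C c)) (hadd : ∀ f g, P f → P g → P (f + g)) (hX : ∀ f, P f → P (X * f)) :
    P f := by
  induction f using Polynomial.induction_on with
  | C a => exact hC a
  | add f g hf hg => exact hadd f g hf hg
  | monomial n a hn =>
    rw [pow_succ, ← mul_assoc, ← X_mul]
    exact hX _ hn

section

variable {k R : Type*} [CommSemiring k] [Semiring R] [Algebra k R]

lemma Polynomial.self_mul_aeval (t : R) (f : k[X]) : t * aeval t f = aeval t f * t := by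
  have h1 := congrArg (aeval t) (mul_comm X f)
  rwa [map_mul, map_mul, aeval_X] at h1

lemma Commute.aeval_right {s t : R} (hst : Commute s t) (f : k[X]) : Commute s (aeval t f) := by
  rw [aeval_eq_sum_range]
  exact Commute.sum_right _ _ _ fun i _ => (hst.pow_right i).smul_right _

end

section DivDiff

variable {k R : Type*} [Field k] [Ring R] [Algebra k R] (s t : R)

/-- The element `∑ i < n, s ^ i * t ^ (n - 1 - i)`. -/
def divDiffPow : ℕ → R
  | 0 => 0
  | n + 1 => s * divDiffPow n + t ^ n

/-- The noncommutative divided difference `f ↦ (f(s) - f(t)) / (s - t)`. -/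
noncomputable def divDiff : k[X] →ₗ[k] R :=
  (basisMonomials k).constr k (divDiffPow s t)

lemma divDiff_monomial (n : ℕ) (c : k) : divDiff s t (monomial n c) = c • divDiffPow s t n := by
  have h1 : monomial n c = c • basisMonomials k n := by
    simp [smul_monomial]
  rw [h1, map_smul, divDiff, Module.Basis.constr_basis]

@[simp]
lemma divDiff_C (c : k) : divDiff s t (C c) = 0 := by
  rw [← monomial_zero_left, divDiff_monomial]
  simp [divDiffPow]

@[simp]
lemma divDiff_X_mul (f : k[X]) : divDiff s t (X * f) = s * divDiff s t f + aeval t f := by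
  induction f using Polynomial.induction_on' with
  | add f g hf hg =>
    rw [mul_add, map_add, hf, hg, map_add, map_add, mul_add]
    abel
  | monomial n a =>
    rw [X_mul_monomial, divDiff_monomial, divDiff_monomial, aeval_monomial, divDiffPow, smul_add,
      mul_smul_comm, Algebra.smul_def a (t ^ n)]

variable {s t}

lemma divDiff_mul_sub (hst : s * t = t * s) (f : k[X]) :
    divDiff s t f * (s - t) = aeval s f - aeval t f := by
  induction f using Polynomial.induction_X_mul with
  | hC c => simp
  | hadd f g hf hg =>
    simp only [map_add, add_mul, hf, hg]
    abel
  | hX f hf =>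
    have h1 : s * aeval t f = aeval t f * s := Commute.aeval_right hst f
    have h2 := self_mul_aeval t f
    rw [divDiff_X_mul, add_mul, mul_assoc, hf, map_mul, map_mul, aeval_X, aeval_X, mul_sub, mul_sub,
      h1, h2]
    abel

end DivDiff

/-! ### Presentation of `A_h`; later arguments use only the three properties in `IsAhAlgebra`. -/

/-- The elements `x`, `y` of the algebra `A` generate it, subject only to the relation
`y * x = x * y + h(x)`. -/
structure IsAhAlgebra {k A : Type u} [Field k] (h : k[X]) [Ring A] [Algebra k A] (x y : A) :
    Prop where
  y_mul_x : y * x = x * y + aeval x h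
  eq_top_of_mul_mem (N : Submodule k A) (one_mem : 1 ∈ N) (x_mul_mem : ∀ a ∈ N, x * a ∈ N)
    (y_mul_mem : ∀ a ∈ N, y * a ∈ N) : N = ⊤
  exists_lift {B : Type u} [Ring B] [Algebra k B] (a b : B) (hab : b * a = a * b + aeval a h) :
    ∃ φ : A →ₐ[k] B, φ x = a ∧ φ y = b

namespace Ah

variable {k : Type u} [Field k] (h : k[X])

/-- The generator `x` of `A_h`. -/
noncomputable def x : Ah h := RingQuot.mkAlgHom k (AhRel h) (FreeAlgebra.ι k 0)

/-- The generator `y` of `A_h`. -/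
noncomputable def y : Ah h := RingQuot.mkAlgHom k (AhRel h) (FreeAlgebra.ι k 1)

lemma y_mul_x : y h * x h = x h * y h + aeval (x h) h := by
  have h1 := RingQuot.mkAlgHom_rel k (s := AhRel h) ⟨rfl, rfl⟩
  rw [map_sub, map_sub, map_mul, map_mul, ← aeval_algHom_apply, map_zero, sub_sub,
    sub_eq_zero] at h1
  exact h1

variable {h}

section Lift

variable {B : Type*} [Ring B] [Algebra k B] (a b : B) (hab : b * a = a * b + aeval a h)

/-- The homomorphism out of `A_h` given by the images of the generators. -/
noncomputable def lift : Ah h →ₐ[k] B :=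
  RingQuot.liftAlgHom k ⟨FreeAlgebra.lift k ![a, b], by
    rintro p q ⟨rfl, rfl⟩
    rw [map_sub, map_sub, map_mul, map_mul, ← aeval_algHom_apply, map_zero]
    simp [hab]⟩

@[simp]
lemma lift_x : lift a b hab (x h) = a := by
  simp [lift, x]

@[simp]
lemma lift_y : lift a b hab (y h) = b := by
  simp [lift, y]

end Lift

lemma eq_top_of_mul_mem (N : Submodule k (Ah h)) (one_mem : 1 ∈ N)
    (x_mul_mem : ∀ a ∈ N, x h * a ∈ N) (y_mul_mem : ∀ a ∈ N, y h * a ∈ N) : N = ⊤ := by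
  have key : ∀ f : FreeAlgebra k (Fin 2), ∀ a ∈ N, RingQuot.mkAlgHom k (AhRel h) f * a ∈ N := by
    intro f
    induction f using FreeAlgebra.induction with
    | grade0 r =>
      intro a ha
      rw [AlgHom.commutes, ← Algebra.smul_def]
      exact N.smul_mem _ ha
    | grade1 i =>
      intro a ha
      fin_cases i
      · exact x_mul_mem a ha
      · exact y_mul_mem a ha
    | mul f g hf hg =>
      intro a ha
      rw [map_mul, mul_assoc]
      exact hf _ (hg _ ha)
    | add f g hf hg =>
      intro a ha
      rw [map_add, add_mul]
      exact N.add_mem (hf _ ha) (hg _ ha)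
  rw [eq_top_iff]
  rintro a -
  obtain ⟨f, rfl⟩ := RingQuot.mkAlgHom_surjective k (AhRel h) a
  simpa using key f 1 one_mem

lemma isAhAlgebra : IsAhAlgebra h (x h) (y h) where
  y_mul_x := y_mul_x h
  eq_top_of_mul_mem := eq_top_of_mul_mem
  exists_lift a b hab := ⟨lift a b hab, lift_x a b hab, lift_y a b hab⟩

end Ah

/-! ### The bimodule complex and its augmentation. -/

section Enveloping

variable (k : Type u) {A : Type u} [Field k] [Ring A] [Algebra k A]

/-- Left multiplication by `a`, as an element of the enveloping algebra. -/
noncomputable def lm : A →ₐ[k] EnvelopingAlgebra k A := Algebra.TensorProduct.includeLeft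

/-- Right multiplication by `a`, as an element of the enveloping algebra. -/
noncomputable def rm : A →ₗ[k] EnvelopingAlgebra k A :=
  Algebra.TensorProduct.includeRight.toLinearMap ∘ₗ (MulOpposite.opLinearEquiv k).toLinearMap

lemma rm_apply (a : A) : rm k a = 1 ⊗ₜ MulOpposite.op a := rfl

lemma lm_apply (a : A) : lm k a = a ⊗ₜ 1 := rfl

lemma rm_mul (a b : A) : rm k (a * b) = rm k b * rm k a := by
  simp [rm_apply]

@[simp]
lemma rm_one : rm k (1 : A) = 1 := rfl

lemma lm_mul_rm (a b : A) : lm k a * rm k b = a ⊗ₜ MulOpposite.op b := by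
  simp [rm_apply, lm_apply]

lemma rm_mul_lm (a b : A) : rm k b * lm k a = lm k a * rm k b := by
  simp [rm_apply, lm_apply]

/-- `rm` reverses products, which is invisible on powers of a single element. -/
lemma aeval_rm (a : A) (f : k[X]) :
    aeval (rm k a : EnvelopingAlgebra k A) f = rm k (aeval a f) := by
  induction f using Polynomial.induction_X_mul with
  | hC c => simp [Algebra.algebraMap_eq_smul_one]
  | hadd f g hf hg => simp [hf, hg]
  | hX f hf =>
    rw [map_mul, map_mul, hf, aeval_X, aeval_X, self_mul_aeval, rm_mul]

end Enveloping

namespace IsAhAlgebra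

variable {k : Type u} [Field k] (h : k[X]) {A : Type u} [Ring A] [Algebra k A] (x y : A)

/-- The `x`-component of the second differential. -/
noncomputable def relX : EnvelopingAlgebra k A :=
  lm k y - rm k y - divDiff (lm k x) (rm k x) h

/-- The `y`-component of the second differential. -/
noncomputable def relY (k : Type u) [Field k] {A : Type u} [Ring A] [Algebra k A] (x : A) :
    EnvelopingAlgebra k A :=
  rm k x - lm k x

/-- The first differential of the bimodule resolution of `A_h`. -/
noncomputable def diff₁ (k : Type u) [Field k] {A : Type u} [Ring A] [Algebra k A] (x y : A) :
    (EnvelopingAlgebra k A × EnvelopingAlgebra k A)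
    →ₗ[EnvelopingAlgebra k A] EnvelopingAlgebra k A :=
  (LinearMap.toSpanSingleton _ _ (lm k x - rm k x)).coprod
    (LinearMap.toSpanSingleton _ _ (lm k y - rm k y))

/-- The second differential of the bimodule resolution of `A_h`. -/
noncomputable def diff₂ : EnvelopingAlgebra k A →ₗ[EnvelopingAlgebra k A]
    (EnvelopingAlgebra k A × EnvelopingAlgebra k A) :=
  (LinearMap.toSpanSingleton _ _ (relX h x y)).prod (LinearMap.toSpanSingleton _ _ (relY k x))

variable {h x y}

lemma diff₁_apply (r q : EnvelopingAlgebra k A) :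
    diff₁ k x y (r, q) = r * (lm k x - rm k x) + q * (lm k y - rm k y) := by
  simp [diff₁]

lemma diff₂_apply (r : EnvelopingAlgebra k A) :
    diff₂ h x y r = (r * relX h x y, r * relY k x) := by
  simp [diff₂]

/-- The divided difference times `lm k x - rm k x` is `h(x) ⊗ 1 - 1 ⊗ h(x)`, which cancels the two
terms in `h` produced by reordering `x` and `y` in each factor. -/
lemma relX_mul_add_relY_mul (hA : IsAhAlgebra h x y) :
    relX h x y * (lm k x - rm k x) + relY k x * (lm k y - rm k y) = 0 := by
  have h1 : lm k y * lm k x = lm k x * lm k y + aeval (lm k x) h := by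
    rw [← map_mul, hA.y_mul_x, map_add, map_mul, aeval_algHom_apply]
  have h2 : rm k x * rm k y = rm k y * rm k x + aeval (rm k x) h := by
    rw [← rm_mul, hA.y_mul_x, map_add, rm_mul, aeval_rm]
  rw [relX, relY, sub_mul _ (divDiff _ _ _), divDiff_mul_sub (rm_mul_lm _ _ _).symm]
  simp only [sub_mul, mul_sub, h1, h2, rm_mul_lm]
  abel

lemma diff₁_comp_diff₂ (hA : IsAhAlgebra h x y) : diff₁ k x y ∘ₗ diff₂ h x y = 0 := by
  ext
  simp [diff₂_apply, diff₁_apply, hA.relX_mul_add_relY_mul]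

section Augmentation

variable (k A)

/-- `A` as a left module over its enveloping algebra. -/
noncomputable instance regularModule : Module (EnvelopingAlgebra k A) A :=
  TensorProduct.Algebra.module

/-- The multiplication `A ⊗ Aᵐᵒᵖ → A`. -/
noncomputable def augmentation : EnvelopingAlgebra k A →ₗ[EnvelopingAlgebra k A] A :=
  LinearMap.toSpanSingleton _ _ 1

variable {k A}

lemma lm_smul (a m : A) : (lm k a : EnvelopingAlgebra k A) • m = a * m := by
  simp [lm_apply, TensorProduct.Algebra.smul_def]

lemma rm_smul (a m : A) : (rm k a : EnvelopingAlgebra k A) • m = m * a := by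
  simp [rm_apply, TensorProduct.Algebra.smul_def]

lemma augmentation_tmul (a b : A) : augmentation k A (a ⊗ₜ MulOpposite.op b) = a * b := by
  simp [augmentation, TensorProduct.Algebra.smul_def]

lemma augmentation_surjective : Function.Surjective (augmentation k A) := fun a =>
  ⟨a ⊗ₜ MulOpposite.op 1, by rw [augmentation_tmul, mul_one]⟩

lemma augmentation_comp_diff₁ : augmentation k A ∘ₗ diff₁ k x y = 0 := by
  have key : ∀ a : A, augmentation k A (lm k a - rm k a) = 0 := fun a => by
    rw [augmentation, LinearMap.toSpanSingleton_apply, sub_smul, lm_smul, rm_smul, mul_one,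
      one_mul, sub_self]
  ext <;> simp [diff₁_apply, key]

/-- `a ↦ a ⊗ 1 - 1 ⊗ a` obeys the Leibniz rule, so the elements with this property are closed under
products; they include `x` and `y`. -/
lemma lm_sub_rm_mem_range_diff₁ (hA : IsAhAlgebra h x y) (a : A) :
    lm k a - rm k a ∈ LinearMap.range (diff₁ k x y) := by
  let N : Submodule k A :=
    ((LinearMap.range (diff₁ k x y)).restrictScalars k).comap ((lm k (A := A)).toLinearMap - rm k)
  have hN : ∀ a b : A, a ∈ N → b ∈ N → a * b ∈ N := fun a b ha hb => by
    change lm k a - rm k a ∈ LinearMap.range (diff₁ k x y) at ha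
    change lm k b - rm k b ∈ LinearMap.range (diff₁ k x y) at hb
    change lm k (a * b) - rm k (a * b) ∈ LinearMap.range (diff₁ k x y)
    have : lm k (a * b) - rm k (a * b) =
        lm k a * (lm k b - rm k b) + rm k b * (lm k a - rm k a) := by
      rw [map_mul, rm_mul, mul_sub, mul_sub, rm_mul_lm]
      abel
    rw [this]
    exact add_mem (Submodule.smul_mem _ (lm k a) hb) (Submodule.smul_mem _ (rm k b) ha)
  have : N = ⊤ := by
    apply hA.eq_top_of_mul_mem
    · change lm k 1 - rm k 1 ∈ LinearMap.range (diff₁ k x y)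
      rw [map_one, rm_one, sub_self]
      exact zero_mem _
    · exact fun a ha => hN _ _ ⟨(1, 0), by simp [diff₁_apply]⟩ ha
    · exact fun a ha => hN _ _ ⟨(0, 1), by simp [diff₁_apply]⟩ ha
  exact this.ge (Submodule.mem_top (x := a))

lemma exact_diff₁_augmentation (hA : IsAhAlgebra h x y) :
    Function.Exact (diff₁ k x y) (augmentation k A) := by
  rw [LinearMap.exact_iff]
  refine le_antisymm ?_ (LinearMap.range_le_ker_iff.2 augmentation_comp_diff₁)
  -- On pure tensors, `a ⊗ b - 1 ⊗ ab = (1 ⊗ b)(a ⊗ 1 - 1 ⊗ a)`.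
  have key : ∀ r : EnvelopingAlgebra k A,
      r - rm k (augmentation k A r) ∈ LinearMap.range (diff₁ k x y) := by
    intro r
    induction r using TensorProduct.induction_on with
    | zero => simp
    | tmul a b =>
      obtain ⟨b, rfl⟩ := MulOpposite.op_surjective b
      rw [augmentation_tmul, ← lm_mul_rm, ← rm_mul_lm, rm_mul, ← mul_sub]
      exact Submodule.smul_mem _ (rm k b) (hA.lm_sub_rm_mem_range_diff₁ a)
    | add r q hr hq =>
      rw [map_add, map_add, add_sub_add_comm]
      exact add_mem hr hq
  intro r hr
  rw [LinearMap.mem_ker] at hr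
  simpa [hr] using key r

end Augmentation

/-! ### Derivations into a bimodule, and exactness in the middle. -/

section Derivation

variable {Q : Type u} [AddCommGroup Q] [Module k Q] [Module (EnvelopingAlgebra k A) Q]
  [IsScalarTower k (EnvelopingAlgebra k A) Q]

/-- The triangular operator `(w, c) ↦ (a • w + q • c, a * c)` on `Q × A`. -/
noncomputable def triangular (k : Type u) [Field k] {A : Type u} [Ring A] [Algebra k A] {Q : Type u}
    [AddCommGroup Q] [Module k Q] [Module (EnvelopingAlgebra k A) Q]
    [IsScalarTower k (EnvelopingAlgebra k A) Q] (a : A) (q : Q) : Module.End k (Q × A) :=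
  ((Algebra.lsmul k k Q (lm k a)).coprod
    (LinearMap.toSpanSingleton (EnvelopingAlgebra k A) Q q ∘ₗ rm k)).prod
    ((LinearMap.mulLeft k a) ∘ₗ LinearMap.snd k Q A)

@[simp]
lemma triangular_apply (a : A) (q w : Q) (c : A) :
    triangular k a q (w, c) = (lm k a • w + rm k c • q, a * c) := rfl

/-- A polynomial in a triangular matrix has a divided difference in its off-diagonal corner; this is
the source of the `divDiff` term in `relX`. -/
lemma aeval_triangular (a : A) (q w : Q) (c : A) (f : k[X]) :
    aeval (triangular k a q) f (w, c) =
      (aeval (lm k a) f • w + rm k c • divDiff (lm k a) (rm k a) f • q, aeval a f * c) := by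
  induction f using Polynomial.induction_X_mul with
  | hC r =>
    have h1 : (0 : EnvelopingAlgebra k A) • q = 0 := zero_smul (EnvelopingAlgebra k A) q
    rw [divDiff_C, h1]
    simp [Algebra.algebraMap_eq_smul_one]
  | hadd f g hf hg =>
    simp only [map_add, LinearMap.add_apply, hf, hg, add_smul, add_mul, smul_add, Prod.mk_add_mk]
    congr 1
    abel
  | hX f hf =>
    rw [map_mul, aeval_X, Module.End.mul_apply, hf, triangular_apply, divDiff_X_mul,
      map_mul (aeval (lm k a)), aeval_X, map_mul (aeval a), aeval_X, mul_assoc, aeval_rm k,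
      rm_mul k]
    simp only [smul_add, add_smul, mul_smul, add_assoc]
    rw [← mul_smul (lm k a) (rm k c), ← rm_mul_lm, mul_smul]

/-- A derivation is the corner of an algebra map into triangular operators on `Q × A`. The
hypothesis `hq` says exactly that the operators chosen for `x` and `y` satisfy the defining
relation. -/
lemma exists_derivation (hA : IsAhAlgebra h x y) (q₁ q₂ : Q)
    (hq : relX h x y • q₁ + relY k x • q₂ = 0) :
    ∃ D : A →ₗ[k] Q, D x = q₁ ∧ D y = q₂ ∧
      ∀ a b, D (a * b) = lm k a • D b + rm k b • D a := by
  have hrel : triangular k y q₂ * triangular k x q₁ =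
      triangular k x q₁ * triangular k y q₂ + aeval (triangular k x q₁) h := by
    refine LinearMap.ext ?_
    rintro ⟨w, c⟩
    have h1 : lm k y * lm k x = lm k x * lm k y + aeval (lm k x) h := by
      rw [← map_mul, hA.y_mul_x, map_add, map_mul, aeval_algHom_apply]
    have h2 : lm k y • q₁ + rm k x • q₂ = lm k x • q₂ + rm k y • q₁ +
        divDiff (lm k x) (rm k x) h • q₁ := by
      rw [relX, relY] at hq
      rw [← sub_eq_zero, ← hq]
      simp only [sub_smul]
      abel
    rw [LinearMap.add_apply, aeval_triangular, Module.End.mul_apply, Module.End.mul_apply,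
      triangular_apply, triangular_apply, triangular_apply, triangular_apply, Prod.mk_add_mk]
    congr 1
    · simp only [smul_add, rm_mul, ← mul_smul _ _ w, h1, add_smul]
      rw [← mul_smul (lm k y) (rm k c), ← mul_smul (lm k x) (rm k c), ← rm_mul_lm,
        ← rm_mul_lm]
      simp only [mul_smul]
      have h3 := congrArg (fun z => rm k c • z) h2
      simp only [smul_add] at h3
      rw [add_assoc, h3]
      abel
    · rw [← mul_assoc, ← mul_assoc, hA.y_mul_x, add_mul]
  obtain ⟨Φ, hx, hy⟩ := hA.exists_lift _ _ hrel
  let D : A →ₗ[k] Q := LinearMap.fst k Q A ∘ₗ LinearMap.applyₗ (0, 1) ∘ₗ Φ.toLinearMap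
  have hD : ∀ a, D a = (Φ a (0, 1)).1 := fun _ => rfl
  -- The elements acting by a triangular operator with corner `D a`. Once this is everything,
  -- multiplicativity of `Φ` becomes the Leibniz rule.
  let N : Submodule k A :=
    { carrier := {a | ∀ w c, Φ a (w, c) = (lm k a • w + rm k c • D a, a * c)}
      zero_mem' := fun w c => by
        have h1 : (0 : EnvelopingAlgebra k A) • w = 0 := zero_smul (EnvelopingAlgebra k A) w
        rw [map_zero, map_zero, map_zero, h1]
        simp only [smul_zero, add_zero, zero_mul]
        rfl
      add_mem' := fun {a b} ha hb w c => by
        rw [map_add, LinearMap.add_apply, ha, hb, map_add, map_add, add_mul, Prod.mk_add_mk,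
          add_smul, smul_add]
        congr 1
        abel
      smul_mem' := fun r a ha w c => by
        rw [map_smul, LinearMap.smul_apply, ha, map_smul, map_smul, smul_mul_assoc, Prod.smul_mk,
          smul_add, smul_assoc, smul_algebra_smul_comm] }
  have hmul : ∀ (b : A) (q : Q), Φ b = triangular k b q → ∀ a ∈ N, b * a ∈ N := by
    intro b q hb a ha w c
    have h1 : D (b * a) = lm k b • D a + rm k a • q := by
      rw [hD, map_mul, Module.End.mul_apply, ha, hb, triangular_apply]
      simp
    rw [map_mul, Module.End.mul_apply, ha, hb, triangular_apply, h1, map_mul (lm k), mul_assoc,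
      rm_mul]
    simp only [smul_add, mul_smul]
    rw [← mul_smul (lm k b) (rm k c), ← rm_mul_lm, mul_smul, add_assoc]
  have hN : N = ⊤ := by
    refine hA.eq_top_of_mul_mem N ?_ (hmul _ _ hx) (hmul _ _ hy)
    intro w c
    simp [hD]
  have key : ∀ a w c, Φ a (w, c) = (lm k a • w + rm k c • D a, a * c) := fun a =>
    hN.ge (Submodule.mem_top (x := a))
  refine ⟨D, ?_, ?_, fun a b => ?_⟩
  · rw [hD, hx, triangular_apply]
    simp
  · rw [hD, hy, triangular_apply]
    simp
  · rw [hD, map_mul, Module.End.mul_apply, key b, key a]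
    simp

/-- Take `E (a ⊗ b) = D(a) b`; then `E (ac ⊗ b - a ⊗ cb) = a D(c) b` by the Leibniz rule. -/
lemma exists_extension_of_derivation (D : A →ₗ[k] Q)
    (hD : ∀ a b, D (a * b) = lm k a • D b + rm k b • D a) :
    ∃ E : EnvelopingAlgebra k A →ₗ[k] Q, ∀ c r, E (r * (lm k c - rm k c)) = r • D c := by
  let E : EnvelopingAlgebra k A →ₗ[k] Q := TensorProduct.lift
    (((Algebra.lsmul k k Q).toLinearMap ∘ₗ rm k ∘ₗ
      (MulOpposite.opLinearEquiv k).symm.toLinearMap).flip ∘ₗ D)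
  have hE : ∀ a b : A, E (a ⊗ₜ MulOpposite.op b) = rm k b • D a := fun _ _ => rfl
  refine ⟨E, fun c r => ?_⟩
  induction r using TensorProduct.induction_on with
  | zero =>
    rw [zero_mul, map_zero]
    exact (zero_smul (EnvelopingAlgebra k A) (D c)).symm
  | tmul a b =>
    obtain ⟨b, rfl⟩ := MulOpposite.op_surjective b
    rw [← lm_mul_rm, mul_sub, mul_assoc, mul_assoc, rm_mul_lm, ← rm_mul, ← mul_assoc, ← map_mul,
      lm_mul_rm, lm_mul_rm, map_sub, hE, hE, hD, rm_mul, ← rm_mul_lm, smul_add, mul_smul,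
      mul_smul]
    abel
  | add r q hr hq => rw [add_mul, map_add, hr, hq, add_smul]

end Derivation

/-- In the cokernel of `diff₂` the classes of `(1, 0)` and `(0, 1)` satisfy the differentiated
relation, hence are `D x` and `D y` for a derivation `D`. Its extension `E` sends `diff₁ (r, q)` to
the class of `(r, q)`, so that class vanishes on the kernel. -/
lemma exact_diff₂_diff₁ (hA : IsAhAlgebra h x y) :
    Function.Exact (diff₂ h x y) (diff₁ k x y) := by
  rw [LinearMap.exact_iff]
  refine le_antisymm ?_ (LinearMap.range_le_ker_iff.2 hA.diff₁_comp_diff₂)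
  let N := LinearMap.range (diff₂ h x y)
  have hrel : relX h x y • N.mkQ (1, 0) + relY k x • N.mkQ (0, 1) = 0 := by
    rw [← map_smul, ← map_smul, ← map_add]
    exact (Submodule.Quotient.mk_eq_zero N).2 ⟨1, by simp [diff₂_apply]⟩
  obtain ⟨D, hx, hy, hD⟩ := hA.exists_derivation _ _ hrel
  obtain ⟨E, hEr⟩ := exists_extension_of_derivation D hD
  rintro ⟨r, q⟩ hrq
  rw [LinearMap.mem_ker, diff₁_apply] at hrq
  have h1 := congrArg E hrq
  rw [map_add, hEr, hEr, map_zero, hx, hy, ← map_smul, ← map_smul, ← map_add] at h1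
  have h2 := (Submodule.Quotient.mk_eq_zero N).1 h1
  rwa [Prod.smul_mk, Prod.smul_mk, Prod.mk_add_mk, smul_zero, smul_zero, smul_eq_mul, smul_eq_mul,
    mul_one, mul_one, add_zero, zero_add] at h2

end IsAhAlgebra

/-! ### Normal form: the basis `x^i y^j`, and injectivity of `diff₂`. -/

section CoeffDerivation

variable {k : Type*} [Field k] (h : k[X])

/-- The operator `h * d/dx` on `k[x]`, applied to the coefficients of a polynomial in `y`. -/
noncomputable def coeffDerivation : k[X][X] →ₗ[k] k[X][X] :=
  lsum fun n => (monomial n).restrictScalars k ∘ₗ LinearMap.mulLeft k h ∘ₗ derivative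

@[simp]
lemma coeffDerivation_monomial (n : ℕ) (f : k[X]) :
    coeffDerivation h (monomial n f) = monomial n (h * derivative f) := by
  rw [coeffDerivation, lsum_apply, sum_monomial_index _ _ (by simp)]
  rfl

lemma coeff_coeffDerivation (p : k[X][X]) (n : ℕ) :
    (coeffDerivation h p).coeff n = h * derivative (p.coeff n) := by
  induction p using Polynomial.induction_on' with
  | add p q hp hq => simp [hp, hq, mul_add]
  | monomial m a =>
    rw [coeffDerivation_monomial, coeff_monomial, coeff_monomial]
    split_ifs <;> simp

end CoeffDerivation

namespace IsAhAlgebra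

variable {k : Type u} [Field k] {h : k[X]} {A : Type u} [Ring A] [Algebra k A] {x y : A}

lemma y_mul_aeval (hA : IsAhAlgebra h x y) (f : k[X]) :
    y * aeval x f = aeval x f * y + aeval x (h * derivative f) := by
  induction f using Polynomial.induction_X_mul with
  | hC c =>
    rw [aeval_C, ← Algebra.commutes]
    simp
  | hadd f g hf hg =>
    simp only [map_add, mul_add, add_mul, hf, hg]
    abel
  | hX f hf =>
    rw [map_mul, aeval_X, ← mul_assoc, hA.y_mul_x, add_mul, mul_assoc, hf, derivative_mul,
      derivative_X, one_mul, mul_add, mul_add, map_add, mul_left_comm h X, map_mul _ X, aeval_X,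
      map_mul _ h f, mul_assoc, add_assoc, add_comm (aeval x h * _)]

variable (k x y)

/-- The element of `A` in normal form given by a polynomial in `y` with coefficients in `k[x]`
written on the left. -/
noncomputable def normal : k[X][X] →ₗ[k] A where
  toFun p := p.eval₂ (aeval x : k[X] →ₐ[k] A).toRingHom y
  map_add' p q := eval₂_add _ _
  map_smul' c p := by
    have h1 : c • p = (C c : k[X]) • p := by
      ext1 n
      rw [coeff_smul, coeff_smul, smul_eq_mul, smul_eq_C_mul]
    rw [h1, eval₂_smul]
    simp [Algebra.smul_def]

variable {k x y}

lemma normal_apply (p : k[X][X]) :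
    normal k x y p = p.eval₂ (aeval x : k[X] →ₐ[k] A).toRingHom y := rfl

@[simp]
lemma normal_C (f : k[X]) : normal k x y (C f) = aeval x f := by
  rw [normal_apply, eval₂_C]
  rfl

@[simp]
lemma normal_C_mul (f : k[X]) (p : k[X][X]) :
    normal k x y (C f * p) = aeval x f * normal k x y p := by
  rw [← smul_eq_C_mul, normal_apply, eval₂_smul]
  rfl

@[simp]
lemma normal_mul_X (p : k[X][X]) : normal k x y (p * X) = normal k x y p * y := by
  rw [normal_apply, eval₂_mul_X]
  rfl

lemma normal_X_pow (n : ℕ) : normal k x y (X ^ n) = y ^ n := by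
  rw [normal_apply, eval₂_X_pow]

@[simp]
lemma normal_monomial (n : ℕ) (f : k[X]) :
    normal k x y (monomial n f) = aeval x f * y ^ n := by
  rw [← C_mul_X_pow_eq_monomial, normal_C_mul, normal_X_pow]

lemma y_mul_normal (hA : IsAhAlgebra h x y) (p : k[X][X]) :
    y * normal k x y p = normal k x y (p * X + coeffDerivation h p) := by
  induction p using Polynomial.induction_on' with
  | add p q hp hq =>
    rw [map_add, mul_add, hp, hq, ← map_add, map_add (coeffDerivation h), add_mul]
    congr 1
    abel
  | monomial n a =>
    rw [coeffDerivation_monomial, map_add, normal_mul_X, normal_monomial, normal_monomial,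
      ← mul_assoc, hA.y_mul_aeval, add_mul, mul_assoc, mul_assoc, ← pow_succ', ← pow_succ]

lemma normal_surjective (hA : IsAhAlgebra h x y) : Function.Surjective (normal k x y) := by
  rw [← LinearMap.range_eq_top]
  refine hA.eq_top_of_mul_mem _ ⟨C 1, by rw [normal_C, map_one]⟩ ?_ ?_
  · rintro _ ⟨p, rfl⟩
    exact ⟨C X * p, by rw [normal_C_mul, aeval_X]⟩
  · rintro _ ⟨p, rfl⟩
    exact ⟨_, (hA.y_mul_normal p).symm⟩

/-- Let `A` act on `k[x][y]`, with `x` acting by multiplication and `y` by multiplication by `y`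
plus `h d/dx`. The normal form of `p` sends `1` to `p`. -/
lemma normal_injective (hA : IsAhAlgebra h x y) : Function.Injective (normal k x y) := by
  let a : Module.End k k[X][X] := Algebra.lmul k k[X][X] (C X)
  let b : Module.End k k[X][X] := Algebra.lmul k k[X][X] X + coeffDerivation h
  have ha : ∀ f : k[X], aeval a f = Algebra.lmul k k[X][X] (C f) := by
    intro f
    rw [aeval_algHom_apply]
    congr 1
    induction f using Polynomial.induction_X_mul with
    | hC c => simp [algebraMap_eq]
    | hadd f g hf hg => rw [map_add, hf, hg, C_add]
    | hX f hf => rw [map_mul, aeval_X, hf, C_mul]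
  have hb : ∀ p, b p = X * p + coeffDerivation h p := fun p => rfl
  have hab : b * a = a * b + aeval a h := by
    refine LinearMap.ext fun p => ?_
    rw [ha]
    change X * (C X * p) + coeffDerivation h (C X * p) =
      C X * (X * p + coeffDerivation h p) + C h * p
    have : coeffDerivation h (C X * p) = C X * coeffDerivation h p + C h * p := by
      ext1 n
      simp only [coeff_coeffDerivation, coeff_C_mul, coeff_add, derivative_mul, derivative_X]
      ring
    rw [this]
    ring
  obtain ⟨φ, hx, hy⟩ := hA.exists_lift a b hab
  have hbpow : ∀ n : ℕ, (b ^ n) 1 = X ^ n := by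
    intro n
    induction n with
    | zero => simp
    | succ n ih =>
      have : coeffDerivation h (X ^ n) = 0 := by
        rw [X_pow_eq_monomial, coeffDerivation_monomial, derivative_one, mul_zero,
          monomial_zero_right]
      rw [pow_succ', Module.End.mul_apply, ih, hb, this, add_zero, pow_succ']
  have key : ∀ p, φ (normal k x y p) 1 = p := by
    intro p
    induction p using Polynomial.induction_on' with
    | add p q hp hq => rw [map_add, map_add, LinearMap.add_apply, hp, hq]
    | monomial n f =>
      rw [normal_monomial, map_mul, map_pow, ← aeval_algHom_apply, hx, hy, Module.End.mul_apply,
        hbpow, ha, ← C_mul_X_pow_eq_monomial]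
      rfl
  exact Function.LeftInverse.injective (g := fun c => φ c 1) key

/-- `A` has the monomials `x ^ i * y ^ j` as a basis. -/
noncomputable def normalEquiv (hA : IsAhAlgebra h x y) : k[X][X] ≃ₗ[k] A :=
  LinearEquiv.ofBijective (normal k x y) ⟨hA.normal_injective, hA.normal_surjective⟩

lemma normalEquiv_apply (hA : IsAhAlgebra h x y) (p : k[X][X]) :
    hA.normalEquiv p = normal k x y p := rfl

/-- The basis of the opposite algebra of `A` given by the monomials `x ^ i * y ^ j`. -/
noncomputable def opBasis (hA : IsAhAlgebra h x y) : Module.Basis (ℕ × ℕ) k Aᵐᵒᵖ :=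
  ((basisMonomials k).smulTower (basisMonomials k[X])).map
    (hA.normalEquiv ≪≫ₗ MulOpposite.opLinearEquiv k)

lemma opBasis_repr (hA : IsAhAlgebra h x y) (c : A) (i j : ℕ) :
    hA.opBasis.repr (MulOpposite.op c) (i, j) = ((hA.normalEquiv.symm c).coeff j).coeff i := by
  rw [opBasis, Module.Basis.map_repr, LinearEquiv.trans_apply, Module.Basis.smulTower_repr]
  rfl

lemma opBasis_repr_x_mul (hA : IsAhAlgebra h x y) (c : A) (i j : ℕ) :
    hA.opBasis.repr (MulOpposite.op (x * c)) (i + 1, j) =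
      hA.opBasis.repr (MulOpposite.op c) (i, j) := by
  obtain ⟨p, rfl⟩ := hA.normalEquiv.surjective c
  have h1 : x * hA.normalEquiv p = hA.normalEquiv (C X * p) := by
    rw [normalEquiv_apply, normalEquiv_apply, normal_C_mul, aeval_X]
  rw [opBasis_repr, opBasis_repr, h1, LinearEquiv.symm_apply_apply, LinearEquiv.symm_apply_apply,
    coeff_C_mul, coeff_X_mul]

/-- The second component `relY` suffices. Expanding the right tensor factor in the monomial basis,
`r * relY = 0` forces the coefficients to satisfy `F(i,j) = F(i+1,j) x`; as they have finite
support, all vanish. -/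
lemma diff₂_injective (hA : IsAhAlgebra h x y) : Function.Injective (diff₂ h x y) := by
  classical
  rw [injective_iff_map_eq_zero]
  intro r hr
  rw [diff₂_apply, Prod.mk_eq_zero] at hr
  replace hr := hr.2
  let F := TensorProduct.equivFinsuppOfBasisRight (M := A) hA.opBasis
  have hF : ∀ (a c : A) i, F (a ⊗ₜ MulOpposite.op c) i =
      hA.opBasis.repr (MulOpposite.op c) i • a := fun a c i =>
    TensorProduct.equivFinsuppOfBasisRight_apply_tmul_apply _ _ _ _
  have hstep : ∀ (q : EnvelopingAlgebra k A) (i j : ℕ),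
      F (q * relY k x) (i + 1, j) = F q (i, j) - F q (i + 1, j) * x := by
    intro q i j
    induction q using TensorProduct.induction_on with
    | zero =>
      rw [zero_mul, map_zero]
      simp
    | add q q' hq hq' =>
      rw [add_mul, map_add, map_add, Finsupp.add_apply, Finsupp.add_apply, Finsupp.add_apply, hq,
        hq', add_mul]
      abel
    | tmul a c =>
      obtain ⟨c, rfl⟩ := MulOpposite.op_surjective c
      have : a ⊗ₜ[k] MulOpposite.op c * relY k x =
          a ⊗ₜ[k] MulOpposite.op (x * c) - (a * x) ⊗ₜ[k] MulOpposite.op c := by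
        simp [relY, mul_sub, rm_apply, lm_apply]
      rw [this, map_sub, Finsupp.sub_apply, hF, hF, hF, hF, opBasis_repr_x_mul, smul_mul_assoc]
  have hzero : ∀ i j, F r (i, j) = F r (i + 1, j) * x := by
    intro i j
    rw [← sub_eq_zero, ← hstep, hr, map_zero, Finsupp.zero_apply]
  have hzero' : ∀ n i j, F r (i, j) = F r (i + n, j) * x ^ n := by
    intro n
    induction n with
    | zero => simp
    | succ n ih =>
      intro i j
      rw [ih, hzero, mul_assoc, ← pow_succ', add_assoc]
  apply F.injective
  rw [map_zero]
  ext ⟨i, j⟩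
  obtain ⟨n, hn⟩ : ∃ n, (i + n, j) ∉ (F r).support := by
    have hinj : Function.Injective fun n : ℕ => (i + n, j) := fun a b hab => by simpa using hab
    exact Infinite.exists_notMem_finset ((F r).support.preimage _ hinj.injOn) |>.imp
      fun n hn => by simpa using hn
  rw [hzero' n, Finsupp.notMem_support_iff.1 hn, zero_mul, Finsupp.zero_apply]

end IsAhAlgebra

/-! ### Commutators with `x` in characteristic zero. -/

lemma Polynomial.exists_derivative_eq {k : Type*} [Field k] [CharZero k] (f : k[X]) :
    ∃ g : k[X], derivative g = f := by
  induction f using Polynomial.induction_on' with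
  | add f g hf hg =>
    obtain ⟨a, rfl⟩ := hf
    obtain ⟨b, rfl⟩ := hg
    exact ⟨a + b, derivative_add⟩
  | monomial n c =>
    refine ⟨monomial (n + 1) (c / (n + 1 : ℕ)), ?_⟩
    rw [derivative_monomial, Nat.add_sub_cancel,
      div_mul_cancel₀ _ (by exact_mod_cast n.succ_ne_zero)]

namespace IsAhAlgebra

variable {k : Type u} [Field k] {h : k[X]} {A : Type u} [Ring A] [Algebra k A] {x y : A}

lemma exists_commutator_y_pow (hA : IsAhAlgebra h x y) (n : ℕ) :
    ∃ p : k[X][X], (∀ m, n < m → p.coeff m = 0) ∧ p.coeff n = (n + 1 : ℕ) ∧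
      y ^ (n + 1) * x - x * y ^ (n + 1) = aeval x h * normal k x y p := by
  induction n with
  | zero =>
    refine ⟨C 1, fun m hm => coeff_C_of_ne_zero hm.ne', by simp, ?_⟩
    rw [normal_C, map_one, mul_one, zero_add, pow_one, hA.y_mul_x, add_sub_cancel_left]
  | succ n ih =>
    obtain ⟨p, hp, hpn, hpy⟩ := ih
    -- From `[y^(n+2),x] = y[y^(n+1),x] + [y,x]y^(n+1)` and `yh = hy + hh'`, after factoring `h` out
    -- on the left.
    refine ⟨p * X + coeffDerivation h p + C (derivative h) * p + X ^ (n + 1), ?_, ?_, ?_⟩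
    · rintro (_ | m) hm
      · omega
      · simp [coeff_coeffDerivation, coeff_X_pow, hp m (by omega), hp (m + 1) (by omega),
          show m ≠ n by omega]
    · simp [coeff_coeffDerivation, hp (n + 1) (by omega), hpn]
    · have h1 : y ^ (n + 1 + 1) * x - x * y ^ (n + 1 + 1) =
          y * (y ^ (n + 1) * x - x * y ^ (n + 1)) + (y * x - x * y) * y ^ (n + 1) := by
        rw [pow_succ' y (n + 1)]
        noncomm_ring
      rw [h1, hpy, hA.y_mul_x, add_sub_cancel_left, ← mul_assoc, hA.y_mul_aeval, map_add, map_add,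
        ← hA.y_mul_normal, normal_C_mul, normal_X_pow, map_mul]
      noncomm_ring

lemma exists_commutator (hA : IsAhAlgebra h x y) (n : ℕ) (p : k[X][X])
    (hp : ∀ m, n + 1 < m → p.coeff m = 0) :
    ∃ q : k[X][X], (∀ m, n < m → q.coeff m = 0) ∧
      q.coeff n = (n + 1 : ℕ) * p.coeff (n + 1) ∧
      normal k x y p * x - x * normal k x y p = aeval x h * normal k x y q := by
  induction n generalizing p with
  | zero =>
    have h1 : p = C (p.coeff 0) + monomial 1 (p.coeff 1) := by
      ext1 m
      rcases m with _ | _ | m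
      · simp [coeff_monomial]
      · simp
      · simp [hp (m + 2) (by omega), coeff_monomial]
    refine ⟨C (p.coeff 1), fun m hm => coeff_C_of_ne_zero hm.ne', by simp, ?_⟩
    rw [h1]
    simp only [map_add, normal_C, normal_monomial, pow_one, coeff_add, coeff_C_succ,
      coeff_monomial_same, zero_add, add_mul, mul_add, mul_assoc, hA.y_mul_x]
    have h2 : ∀ f : k[X], x * aeval x f = aeval x f * x := self_mul_aeval x
    rw [← map_mul (aeval x), ← map_mul (aeval x), mul_comm h, h2, ← mul_assoc x, h2]
    noncomm_ring
  | succ n ih =>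
    obtain ⟨t, ht, htn, hty⟩ := hA.exists_commutator_y_pow (n + 1)
    set c := p.coeff (n + 1 + 1)
    obtain ⟨q, hq, hqn, hqy⟩ := ih (p - monomial (n + 2) c) fun m hm => by
      rw [coeff_sub, coeff_monomial]
      split_ifs with h1
      · rw [← h1, sub_self]
      · rw [hp m (by omega), sub_zero]
    refine ⟨q + C c * t, fun m hm => ?_, ?_, ?_⟩
    · rw [coeff_add, coeff_C_mul, ht m hm, hq m (by omega), mul_zero, add_zero]
    · rw [coeff_add, coeff_C_mul, htn, hq _ (by omega), zero_add, mul_comm]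
    · rw [map_add, mul_add, ← hqy, normal_C_mul, ← mul_assoc, ← map_mul, mul_comm h, map_mul,
        mul_assoc (aeval x c), ← hty, map_sub, normal_monomial]
      have h2 : x * aeval x c = aeval x c * x := self_mul_aeval x c
      rw [mul_sub (aeval x c), ← mul_assoc (aeval x c) x, ← h2]
      noncomm_ring

/-- Descent on the degree in `y`: the commutator of `r_n y^(n+1)/(n+1)` with `x` matches the top
term of `h r`. -/
lemma exists_commutator_eq [CharZero k] (hA : IsAhAlgebra h x y) (b : A) :
    ∃ a, a * x - x * a = aeval x h * b := by
  obtain ⟨r, rfl⟩ := hA.normal_surjective b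
  have key : ∀ (n : ℕ) (r : k[X][X]), (∀ m, n ≤ m → r.coeff m = 0) →
      ∃ a, a * x - x * a = aeval x h * normal k x y r := by
    intro n
    induction n with
    | zero =>
      intro r hr
      have : r = 0 := ext fun m => hr m m.zero_le
      exact ⟨0, by simp [this]⟩
    | succ n ih =>
      intro r hr
      have hn : ((n + 1 : ℕ) : k) ≠ 0 := by exact_mod_cast n.succ_ne_zero
      obtain ⟨q, hq, hqn, hqx⟩ := hA.exists_commutator n
        (monomial (n + 1) (C ((n + 1 : ℕ) : k)⁻¹ * r.coeff n))
        fun m hm => coeff_monomial_of_ne _ (by omega)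
      rw [coeff_monomial_same, ← mul_assoc, ← C_eq_natCast, ← C_mul, mul_inv_cancel₀ hn, C_1,
        one_mul] at hqn
      obtain ⟨a, ha⟩ := ih (r - q) fun m hm => by
        rw [coeff_sub]
        rcases hm.eq_or_lt with rfl | hm
        · rw [hqn, sub_self]
        · rw [hr m hm, hq m hm, sub_zero]
      refine ⟨a + normal k x y (monomial (n + 1) (C ((n + 1 : ℕ) : k)⁻¹ * r.coeff n)), ?_⟩
      rw [add_mul, mul_add, add_sub_add_comm, ha, hqx, ← mul_add, ← map_add, sub_add_cancel]
  exact key (r.natDegree + 1) r fun m hm => coeff_eq_zero_of_natDegree_lt hm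

lemma exists_eq_aeval_of_commute [CharZero k] (hA : IsAhAlgebra h x y) (hh : h ≠ 0) {a : A}
    (ha : a * x = x * a) : ∃ f : k[X], a = aeval x f := by
  obtain ⟨p, rfl⟩ := hA.normal_surjective a
  rcases hn : p.natDegree with _ | n
  · rw [natDegree_eq_zero] at hn
    obtain ⟨f, rfl⟩ := hn
    exact ⟨f, normal_C f⟩
  · obtain ⟨q, -, hqn, hqx⟩ := hA.exists_commutator n p fun m hm =>
      coeff_eq_zero_of_natDegree_lt (hn ▸ hm)
    rw [ha, sub_self, ← normal_C_mul, eq_comm, ← map_zero (normal k x y)] at hqx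
    have hq := hA.normal_injective hqx
    rw [mul_eq_zero, C_eq_zero, or_iff_right hh] at hq
    rw [hq, coeff_zero, eq_comm, mul_eq_zero, Nat.cast_eq_zero, or_iff_right n.succ_ne_zero,
      ← hn, coeff_natDegree, leadingCoeff_eq_zero] at hqn
    rw [hqn, natDegree_zero] at hn
    omega

/-! ### The commutative quotients `A/dA` for `d ∣ h`. -/

section Reduction

lemma exists_reduction (hA : IsAhAlgebra h x y) {d : k[X]} (hd : d ∣ h) :
    ∃ φ : A →ₐ[k] (k[X] ⧸ Ideal.span {d})[X],
      ∀ p, φ (normal k x y p) = p.map (Ideal.Quotient.mk (Ideal.span {d})) := by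
  let ρ : k[X] →ₐ[k] (k[X] ⧸ Ideal.span {d})[X] := CAlgHom.comp (Ideal.Quotient.mkₐ k _)
  have hρ : ∀ f, ρ f = C (Ideal.Quotient.mk _ f) := fun f => rfl
  have hρ' : ∀ f, aeval (ρ X) f = ρ f := fun f => by
    rw [aeval_algHom_apply, aeval_X_left_apply]
  obtain ⟨φ, hx, hy⟩ := hA.exists_lift (ρ X) X (by
    have : ρ h = 0 := by
      rw [hρ, Ideal.Quotient.eq_zero_iff_mem.2 (Ideal.mem_span_singleton.2 hd), C_0]
    rw [hρ', this, add_zero]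
    exact mul_comm (G := (k[X] ⧸ Ideal.span {d})[X]) _ _)
  refine ⟨φ, fun p => ?_⟩
  induction p using Polynomial.induction_on' with
  | add p q hp hq => rw [map_add, map_add, hp, hq, Polynomial.map_add]
  | monomial n f =>
    rw [normal_monomial, map_mul, map_pow, ← aeval_algHom_apply, hx, hy, hρ', map_monomial, hρ,
      C_mul_X_pow_eq_monomial]

/-- The reduction of `A` to a commutative polynomial ring, for a divisor `d` of `h`. -/
noncomputable def reduction (hA : IsAhAlgebra h x y) {d : k[X]} (hd : d ∣ h) :
    A →ₐ[k] (k[X] ⧸ Ideal.span {d})[X] :=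
  (hA.exists_reduction hd).choose

variable (hA : IsAhAlgebra h x y) {d : k[X]} (hd : d ∣ h)

lemma reduction_normal (p : k[X][X]) :
    hA.reduction hd (normal k x y p) = p.map (Ideal.Quotient.mk (Ideal.span {d})) :=
  (hA.exists_reduction hd).choose_spec p

lemma reduction_aeval (f : k[X]) :
    hA.reduction hd (aeval x f) = C (Ideal.Quotient.mk (Ideal.span {d}) f) := by
  rw [← normal_C (y := y), reduction_normal, map_C]

lemma reduction_surjective : Function.Surjective (hA.reduction hd) := fun q => by
  obtain ⟨p, rfl⟩ := map_surjective _ Ideal.Quotient.mk_surjective q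
  exact ⟨_, hA.reduction_normal hd p⟩

lemma reduction_eq_zero_iff (a : A) :
    hA.reduction hd a = 0 ↔ ∃ b, a = aeval x d * b := by
  constructor
  · intro ha
    obtain ⟨p, rfl⟩ := hA.normal_surjective a
    rw [reduction_normal] at ha
    have : C d ∣ p := by
      rw [C_dvd_iff_dvd_coeff]
      intro i
      rw [← Ideal.mem_span_singleton, ← Ideal.Quotient.eq_zero_iff_mem, ← coeff_map, ha,
        coeff_zero]
    obtain ⟨q, rfl⟩ := this
    exact ⟨_, normal_C_mul _ _⟩
  · rintro ⟨b, rfl⟩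
    rw [map_mul, reduction_aeval, Ideal.Quotient.eq_zero_iff_mem.2
      (Ideal.mem_span_singleton_self d), C_0, zero_mul]

lemma reduction_commutator (a b : A) : hA.reduction hd (a * b - b * a) = 0 := by
  rw [map_sub, map_mul, map_mul, sub_eq_zero]
  exact mul_comm (G := (k[X] ⧸ Ideal.span {d})[X]) _ _

lemma divDiff_X_mul_smul (f : k[X]) (u : A) :
    divDiff (lm k x) (rm k x) (X * f) • u =
      x * (divDiff (lm k x) (rm k x) f • u) + u * aeval x f := by
  rw [divDiff_X_mul, add_smul, mul_smul, lm_smul, aeval_rm, rm_smul]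

/-- Left and right multiplication by `x` agree in the quotient, so the divided difference collapses
to the derivative. -/
lemma reduction_divDiff_smul (f : k[X]) (u : A) :
    hA.reduction hd (divDiff (lm k x) (rm k x) f • u) =
      C (Ideal.Quotient.mk (Ideal.span {d}) (derivative f)) * hA.reduction hd u := by
  induction f using Polynomial.induction_X_mul with
  | hC c =>
    have h1 : (0 : EnvelopingAlgebra k A) • u = 0 := zero_smul (EnvelopingAlgebra k A) u
    rw [divDiff_C, h1, map_zero, derivative_C, map_zero, C_0, zero_mul]
  | hadd f g hf hg =>
    rw [map_add, add_smul, map_add, hf, hg, derivative_add, map_add, C_add, add_mul]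
  | hX f hf =>
    rw [divDiff_X_mul_smul, map_add, map_mul, map_mul, hf, derivative_mul, derivative_X, one_mul,
      reduction_aeval, map_add, map_mul, C_add, C_mul, ← reduction_aeval hA hd X, aeval_X]
    ring

end Reduction

end IsAhAlgebra

/-- `N ⧸ B` is an extension of `P` by `G`, split because `k` is a field: `F × P` surjects onto both
sides with the same kernel. -/
lemma nonempty_quotient_linearEquiv_prod {k N F G P : Type*} [Field k] [AddCommGroup N]
    [Module k N] [AddCommGroup F] [Module k F] [AddCommGroup G] [Module k G] [AddCommGroup P]
    [Module k P] (B : Submodule k N) (g : F →ₗ[k] G) (hg : Function.Surjective g) (i : F →ₗ[k] N)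
    (π : N →ₗ[k] P) (hπ : Function.Surjective π) (hB : B ≤ LinearMap.ker π)
    (hi : ∀ f, i f ∈ B ↔ g f = 0) (hπi : ∀ f, π (i f) = 0)
    (hker : ∀ n, π n = 0 → ∃ f, n - i f ∈ B) : Nonempty ((N ⧸ B) ≃ₗ[k] G × P) := by
  obtain ⟨s, hs⟩ := π.exists_rightInverse_of_surjective (LinearMap.range_eq_top.2 hπ)
  have hs' : ∀ p, π (s p) = p := fun p => LinearMap.congr_fun hs p
  let ψ : F × P →ₗ[k] N ⧸ B := B.mkQ ∘ₗ i.coprod s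
  let χ : F × P →ₗ[k] G × P := g.prodMap LinearMap.id
  have hψ : Function.Surjective ψ := by
    intro z
    obtain ⟨n, rfl⟩ := B.mkQ_surjective z
    obtain ⟨f, hf⟩ := hker (n - s (π n)) (by rw [map_sub, hs', sub_self])
    refine ⟨(f, π n), ?_⟩
    change B.mkQ (i f + s (π n)) = B.mkQ n
    rw [eq_comm, ← sub_eq_zero, ← map_sub]
    refine (Submodule.Quotient.mk_eq_zero B).2 ?_
    rwa [add_comm, ← sub_sub]
  have hχ : Function.Surjective χ := hg.prodMap Function.surjective_id
  have hker' : LinearMap.ker ψ = LinearMap.ker χ := by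
    ext ⟨f, p⟩
    have h1 : ψ (f, p) = 0 ↔ i f + s p ∈ B := Submodule.Quotient.mk_eq_zero B
    have h2 : χ (f, p) = 0 ↔ g f = 0 ∧ p = 0 := Prod.mk_eq_zero
    rw [LinearMap.mem_ker, LinearMap.mem_ker, h1, h2, ← hi]
    constructor
    · intro hf
      have hp : π (i f + s p) = 0 := hB hf
      rw [map_add, hπi, hs', zero_add] at hp
      subst hp
      exact ⟨by simpa using hf, rfl⟩
    · rintro ⟨hf, rfl⟩
      simpa using hf
  exact ⟨(ψ.quotKerEquivOfSurjective hψ).symm ≪≫ₗ Submodule.quotEquivOfEq _ _ hker' ≪≫ₗ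
    χ.quotKerEquivOfSurjective hχ⟩

/-! ### The ideal `I` as the annihilator of `h'`. -/

section Gcd

variable {k : Type u} [Field k] (h : k[X])

lemma gcdDeriv_dvd : gcdDeriv h ∣ h :=
  @EuclideanDomain.gcd_dvd_left _ _ (Classical.decEq _) _ _

lemma gcdDeriv_dvd_derivative : gcdDeriv h ∣ derivative h :=
  @EuclideanDomain.gcd_dvd_right _ _ (Classical.decEq _) _ _

lemma exists_gcdDeriv_eq : ∃ a b, gcdDeriv h = h * a + derivative h * b :=
  ⟨_, _, @EuclideanDomain.gcd_eq_gcd_ab _ _ (Classical.decEq _) _ _⟩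

variable {h}

/-- With `h = de` and `h' = dg`, the factors `e` and `g` are coprime, so `h ∣ h'c` reduces to `e ∣
c`. -/
lemma mk_mem_idealI_iff (hh : h ≠ 0) (c : k[X]) :
    Ideal.Quotient.mk (Ideal.span {h}) c ∈ idealI h ↔ h ∣ derivative h * c := by
  have hd : gcdDeriv h ≠ 0 := fun h0 => hh (zero_dvd_iff.1 (h0 ▸ gcdDeriv_dvd h))
  obtain ⟨e, he⟩ := gcdDeriv_dvd h
  obtain ⟨g, hg⟩ := gcdDeriv_dvd_derivative h
  obtain ⟨a, b, hab⟩ := exists_gcdDeriv_eq h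
  have hdiv : h / gcdDeriv h = e := by
    exact (congrArg (· / gcdDeriv h) he).trans (mul_div_cancel_left₀ e hd)
  have h1 : 1 = e * a + g * b := by
    apply mul_left_cancel₀ hd
    rw [mul_one, mul_add, ← mul_assoc, ← mul_assoc, ← he, ← hg]
    exact hab
  have h2 : Ideal.Quotient.mk (Ideal.span {h}) c ∈ idealI h ↔ e ∣ c := by
    rw [idealI, hdiv, Ideal.mem_span_singleton]
    constructor
    · rintro ⟨z, hz⟩
      obtain ⟨w, rfl⟩ := Ideal.Quotient.mk_surjective z
      rw [← map_mul, Ideal.Quotient.eq, Ideal.mem_span_singleton] at hz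
      have : e ∣ h := ⟨gcdDeriv h, by rw [mul_comm]; exact he⟩
      exact (dvd_sub_left (dvd_mul_right e w)).1 (this.trans hz)
    · rintro ⟨w, rfl⟩
      exact ⟨Ideal.Quotient.mk _ w, map_mul _ _ _⟩
  rw [h2]
  constructor
  · rintro ⟨w, rfl⟩
    refine ⟨g * w, ?_⟩
    rw [hg]
    conv_rhs => rw [he]
    ring
  · intro hc
    have hc' : e ∣ g * c := by
      rw [← mul_dvd_mul_iff_left hd, ← mul_assoc, ← hg, ← he]
      exact hc
    have : c = e * (a * c) + g * c * b := by
      calc c = (e * a + g * b) * c := by rw [← h1, one_mul]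
        _ = _ := by ring
    rw [this]
    exact dvd_add (dvd_mul_right _ _) (hc'.mul_right b)

lemma map_mk_mem_polynomialsIn_iff (hh : h ≠ 0) (p : k[X][X]) :
    p.map (Ideal.Quotient.mk (Ideal.span {h})) ∈ polynomialsIn k (idealI h) ↔
      C (Ideal.Quotient.mk (Ideal.span {h}) (derivative h)) *
        p.map (Ideal.Quotient.mk (Ideal.span {h})) = 0 := by
  rw [← map_C, ← Polynomial.map_mul, Polynomial.ext_iff]
  refine forall_congr' fun n => ?_
  rw [coeff_map, coeff_map, mk_mem_idealI_iff hh, coeff_C_mul, coeff_zero,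
    Ideal.Quotient.eq_zero_iff_mem, Ideal.mem_span_singleton]

end Gcd

/-! ### The Hochschild cochain complex `A → A × A → A` and its cohomology. -/

section Hom

variable (k : Type u) {A : Type u} [Field k] [Ring A] [Algebra k A]

lemma isScalarTower_regularModule : IsScalarTower k (EnvelopingAlgebra k A) A where
  smul_assoc c r m := by
    induction r using TensorProduct.induction_on with
    | zero =>
      have h1 : (0 : EnvelopingAlgebra k A) • m = 0 := zero_smul (EnvelopingAlgebra k A) m
      rw [smul_zero, h1, smul_zero]
    | add r q hr hq => rw [smul_add, add_smul, hr, hq, add_smul, smul_add]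
    | tmul a b =>
      rw [TensorProduct.smul_tmul']
      simp [TensorProduct.Algebra.smul_def]

lemma linear_smul_hom_apply {R : Type u} [Ring R] [Algebra k R] {M N : ModuleCat.{u} R} (c : k)
    (z : M ⟶ N) (m : M) : (c • z).hom m = algebraMap k R c • z.hom m := rfl

/-- Bimodule homomorphisms out of the free bimodule of rank one. -/
noncomputable def homOfEquiv :
    (ModuleCat.of (EnvelopingAlgebra k A) (EnvelopingAlgebra k A) ⟶
      ModuleCat.of (EnvelopingAlgebra k A) A) ≃ₗ[k] A where
  toFun z := z.hom 1
  map_add' _ _ := rfl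
  map_smul' c z := by
    have h1 := linear_smul_hom_apply k c z (1 : EnvelopingAlgebra k A)
    have := isScalarTower_regularModule k (A := A)
    exact h1.trans (algebraMap_smul (EnvelopingAlgebra k A) c (show A from z.hom 1))
  invFun u := ModuleCat.ofHom (LinearMap.toSpanSingleton _ _ u)
  left_inv z := by
    ext
    simp
  right_inv u := by
    simp

/-- Bimodule homomorphisms out of the free bimodule of rank two. -/
noncomputable def homProdOfEquiv :
    (ModuleCat.of (EnvelopingAlgebra k A) (EnvelopingAlgebra k A × EnvelopingAlgebra k A) ⟶
      ModuleCat.of (EnvelopingAlgebra k A) A) ≃ₗ[k] A × A where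
  toFun z := (z.hom (1, 0), z.hom (0, 1))
  map_add' _ _ := rfl
  map_smul' c z := by
    have h1 := linear_smul_hom_apply k c z
    have := isScalarTower_regularModule k (A := A)
    exact Prod.ext
      ((h1 _).trans (algebraMap_smul (EnvelopingAlgebra k A) c (show A from z.hom (1, 0))))
      ((h1 _).trans (algebraMap_smul (EnvelopingAlgebra k A) c (show A from z.hom (0, 1))))
  invFun u := ModuleCat.ofHom ((LinearMap.toSpanSingleton _ _ u.1).coprod
    (LinearMap.toSpanSingleton _ _ u.2))
  left_inv z := by
    ext <;> simp
  right_inv u := by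
    have h1 : ∀ a : A, (0 : EnvelopingAlgebra k A) • a = 0 := fun a =>
      zero_smul (EnvelopingAlgebra k A) a
    refine Prod.ext ?_ ?_
    · change (1 : EnvelopingAlgebra k A) • u.1 + (0 : EnvelopingAlgebra k A) • u.2 = u.1
      rw [h1, one_smul, add_zero]
    · change (0 : EnvelopingAlgebra k A) • u.1 + (1 : EnvelopingAlgebra k A) • u.2 = u.2
      rw [h1, one_smul, zero_add]

end Hom

namespace IsAhAlgebra

section Cochain

attribute [local instance] isScalarTower_regularModule

variable {k : Type u} [Field k] {h : k[X]} {A : Type u} [Ring A] [Algebra k A] {x y : A}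

variable (k x y) in
/-- The differential from Hochschild `0`-cochains to `1`-cochains. -/
noncomputable def codiff₀ : A →ₗ[k] A × A :=
  (Algebra.lsmul k k A (lm k x - rm k x)).prod (Algebra.lsmul k k A (lm k y - rm k y))

variable (h x y) in
/-- The differential from Hochschild `1`-cochains to `2`-cochains. -/
noncomputable def codiff₁ : A × A →ₗ[k] A :=
  (Algebra.lsmul k k A (relX h x y)).coprod (Algebra.lsmul k k A (relY k x))

lemma codiff₀_apply (a : A) : codiff₀ k x y a = (x * a - a * x, y * a - a * y) := by
  change ((lm k x - rm k x) • a, (lm k y - rm k y) • a) = _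
  rw [sub_smul, sub_smul, lm_smul, lm_smul, rm_smul, rm_smul]

lemma codiff₁_apply (u v : A) : codiff₁ h x y (u, v) = relX h x y • u + relY k x • v := rfl

lemma codiff₁_apply' (u v : A) : codiff₁ h x y (u, v) =
    (y * u - u * y) - divDiff (lm k x) (rm k x) h • u + (v * x - x * v) := by
  rw [codiff₁_apply, relX, relY, sub_smul, sub_smul, sub_smul, lm_smul, lm_smul, rm_smul, rm_smul]

lemma codiff₁_codiff₀ (hA : IsAhAlgebra h x y) (a : A) : codiff₁ h x y (codiff₀ k x y a) = 0 := by
  change relX h x y • (lm k x - rm k x) • a + relY k x • (lm k y - rm k y) • a = 0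
  rw [← mul_smul, ← mul_smul, ← add_smul, hA.relX_mul_add_relY_mul]
  exact zero_smul (EnvelopingAlgebra k A) a

lemma reduction_codiff₁ (hA : IsAhAlgebra h x y) {d : k[X]} (hd : d ∣ h) (u v : A) :
    hA.reduction hd (codiff₁ h x y (u, v)) =
      -(C (Ideal.Quotient.mk (Ideal.span {d}) (derivative h)) * hA.reduction hd u) := by
  rw [codiff₁_apply', map_add, map_sub (hA.reduction hd) (y * u - u * y), reduction_commutator,
    reduction_commutator, reduction_divDiff_smul, zero_sub, add_zero]

lemma exists_codiff₁_eq (hA : IsAhAlgebra h x y) [CharZero k] (b : A) :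
    ∃ v, codiff₁ h x y (0, v) = aeval x h * b := by
  obtain ⟨v, hv⟩ := hA.exists_commutator_eq b
  refine ⟨v, ?_⟩
  rw [codiff₁_apply', hv]
  simp

lemma ker_codiff₀ (hA : IsAhAlgebra h x y) [CharZero k] (hh : h ≠ 0) (a : A) :
    codiff₀ k x y a = 0 ↔ ∃ c : k, a = algebraMap k A c := by
  rw [codiff₀_apply, Prod.mk_eq_zero, sub_eq_zero, sub_eq_zero]
  constructor
  · rintro ⟨hx, hy⟩
    obtain ⟨f, rfl⟩ := hA.exists_eq_aeval_of_commute hh hx.symm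
    rw [hA.y_mul_aeval, add_eq_left, ← normal_C (y := y), ← map_zero (normal k x y)] at hy
    have h1 := hA.normal_injective hy
    rw [C_eq_zero, mul_eq_zero, or_iff_right hh] at h1
    obtain ⟨c, rfl⟩ := natDegree_eq_zero.1 (derivative_eq_zero.1 h1)
    exact ⟨c, aeval_C _ _⟩
  · rintro ⟨c, rfl⟩
    exact ⟨(Algebra.commutes _ _).symm, (Algebra.commutes _ _).symm⟩

lemma range_codiff₁ (hA : IsAhAlgebra h x y) [CharZero k] (a : A) :
    hA.reduction (gcdDeriv_dvd h) a = 0 ↔ ∃ z, codiff₁ h x y z = a := by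
  constructor
  · intro ha
    obtain ⟨b, rfl⟩ := (hA.reduction_eq_zero_iff _ a).1 ha
    obtain ⟨p, q, hpq⟩ := exists_gcdDeriv_eq h
    -- Since `d = hp + h'q`, the cochain `(-(qb), 0)` accounts for `db` modulo `hA`; the remainder
    -- in `hA` is a commutator with `x`.
    have h1 : hA.reduction dvd_rfl
        (aeval x (gcdDeriv h) * b - codiff₁ h x y (-(aeval x q * b), 0)) = 0 := by
      rw [map_sub, reduction_codiff₁, map_neg, map_mul, map_mul, reduction_aeval, reduction_aeval,
        hpq, map_add, map_mul, map_mul, Ideal.Quotient.eq_zero_iff_mem.2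
        (Ideal.mem_span_singleton_self h), zero_mul, zero_add, C_mul]
      ring
    obtain ⟨c, hc⟩ := (hA.reduction_eq_zero_iff _ _).1 h1
    obtain ⟨v, hv⟩ := hA.exists_codiff₁_eq c
    refine ⟨(0, v) + (-(aeval x q * b), 0), ?_⟩
    rw [map_add, hv, ← hc, sub_add_cancel]
  · rintro ⟨⟨u, v⟩, rfl⟩
    rw [reduction_codiff₁, Ideal.Quotient.eq_zero_iff_mem.2
      (Ideal.mem_span_singleton.2 (gcdDeriv_dvd_derivative h)), C_0, zero_mul, neg_zero]

lemma nonempty_cohomology_one_linearEquiv (hA : IsAhAlgebra h x y) [CharZero k] (hh : h ≠ 0) :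
    Nonempty ((LinearMap.ker (codiff₁ h x y) ⧸
      (LinearMap.range (codiff₀ k x y)).submoduleOf (LinearMap.ker (codiff₁ h x y))) ≃ₗ[k]
        (k[X] ⧸ Ideal.span {h}) × polynomialsIn k (idealI h)) := by
  let ρ := hA.reduction dvd_rfl
  have hmem : ∀ u : A, ρ u ∈ polynomialsIn k (idealI h) ↔
      C (Ideal.Quotient.mk (Ideal.span {h}) (derivative h)) * ρ u = 0 := by
    intro u
    obtain ⟨p, rfl⟩ := hA.normal_surjective u
    rw [reduction_normal, map_mk_mem_polynomialsIn_iff hh]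
  have hρ : ∀ z ∈ LinearMap.ker (codiff₁ h x y), ρ z.1 ∈ polynomialsIn k (idealI h) := by
    rintro ⟨u, v⟩ hz
    rw [hmem, ← neg_eq_zero, ← reduction_codiff₁]
    rw [LinearMap.mem_ker] at hz
    rw [hz, map_zero]
  have hi : ∀ f : k[X], ((0 : A), aeval x f) ∈ LinearMap.ker (codiff₁ h x y) := by
    intro f
    rw [LinearMap.mem_ker, codiff₁_apply', ← self_mul_aeval]
    simp
  let i : k[X] →ₗ[k] LinearMap.ker (codiff₁ h x y) :=
    (LinearMap.inr k A A ∘ₗ (aeval x).toLinearMap).codRestrict _ hi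
  let π : LinearMap.ker (codiff₁ h x y) →ₗ[k] polynomialsIn k (idealI h) :=
    (ρ.toLinearMap ∘ₗ LinearMap.fst k A A).restrict hρ
  have hπ : ∀ z, π z = 0 ↔ ρ z.1.1 = 0 := fun z => Subtype.ext_iff
  have hiv : ∀ f, (i f).1 = (0, aeval x f) := fun f => rfl
  refine nonempty_quotient_linearEquiv_prod _ (Ideal.Quotient.mkₐ k (Ideal.span {h})).toLinearMap
    Ideal.Quotient.mk_surjective i π ?_ ?_ ?_ ?_ ?_
  · rintro ⟨w, hw⟩
    obtain ⟨u, rfl⟩ := hA.reduction_surjective dvd_rfl w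
    -- As `h'u` dies modulo `hA`, the defect of `(u, 0)` lies in `hA`, and a second component `v`
    -- cancels it.
    have h1 : hA.reduction dvd_rfl (codiff₁ h x y (u, 0)) = 0 := by
      rw [reduction_codiff₁, (hmem u).1 hw, neg_zero]
    obtain ⟨b, hb⟩ := (hA.reduction_eq_zero_iff _ _).1 h1
    obtain ⟨v, hv⟩ := hA.exists_codiff₁_eq b
    refine ⟨⟨(u, 0) - (0, v), ?_⟩, Subtype.ext ?_⟩
    · rw [LinearMap.mem_ker, map_sub, hb, hv, sub_self]
    · change ρ (u - 0) = ρ u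
      rw [sub_zero]
  · rintro ⟨z, hz⟩ ⟨a, rfl⟩
    rw [LinearMap.mem_ker, hπ]
    change ρ (codiff₀ k x y a).1 = 0
    rw [codiff₀_apply]
    exact hA.reduction_commutator _ _ _
  · intro f
    have h1 : (Ideal.Quotient.mkₐ k (Ideal.span {h})).toLinearMap f = 0 ↔ h ∣ f := by
      rw [← Ideal.mem_span_singleton]
      exact Ideal.Quotient.eq_zero_iff_mem
    have h2 : i f ∈ (LinearMap.range (codiff₀ k x y)).submoduleOf (LinearMap.ker (codiff₁ h x y)) ↔
      ∃ a, codiff₀ k x y a = (0, aeval x f) := Iff.rfl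
    rw [h1, h2]
    constructor
    · rintro ⟨a, ha⟩
      rw [codiff₀_apply, Prod.mk_inj, sub_eq_zero] at ha
      obtain ⟨g, rfl⟩ := hA.exists_eq_aeval_of_commute hh ha.1.symm
      have h2 := ha.2
      rw [hA.y_mul_aeval, add_sub_cancel_left, ← normal_C (y := y), ← normal_C (y := y)] at h2
      exact ⟨_, (C_injective (hA.normal_injective h2)).symm⟩
    · rintro ⟨e, rfl⟩
      obtain ⟨g, rfl⟩ := exists_derivative_eq e
      refine ⟨aeval x g, ?_⟩
      rw [codiff₀_apply, self_mul_aeval, sub_self, hA.y_mul_aeval, add_sub_cancel_left]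
  · intro f
    rw [hπ, hiv, map_zero]
  · rintro ⟨⟨u, v⟩, hz⟩ hz'
    rw [hπ] at hz'
    obtain ⟨b, rfl⟩ := (hA.reduction_eq_zero_iff _ _).1 hz'
    -- Writing `hb = [a,x]`, subtracting the coboundary of `-a` kills the first component; the
    -- second then commutes with `x`, so it is a polynomial in `x`.
    obtain ⟨a, ha⟩ := hA.exists_commutator_eq b
    rw [LinearMap.mem_ker] at hz
    have h1 : codiff₁ h x y ((aeval x h * b, v) - codiff₀ k x y (-a)) = 0 := by
      rw [map_sub, hz, hA.codiff₁_codiff₀, sub_self]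
    have h2 : (aeval x h * b, v) - codiff₀ k x y (-a) = (0, v + (y * a - a * y)) := by
      rw [codiff₀_apply, ← ha, Prod.mk_sub_mk]
      congr 1 <;> noncomm_ring
    rw [h2, codiff₁_apply', mul_zero, zero_mul, sub_self, smul_zero, sub_self, zero_add,
      sub_eq_zero] at h1
    obtain ⟨f, hf⟩ := hA.exists_eq_aeval_of_commute hh h1
    refine ⟨f, -a, ?_⟩
    change codiff₀ k x y (-a) = (aeval x h * b, v) - (i f).1
    rw [hiv, ← hf, ← h2, sub_sub_cancel]

end Cochain

end IsAhAlgebra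

/-! ### Identification with Ext and conclusion. -/

namespace IsAhAlgebra

variable {k : Type u} [Field k] {h : k[X]} {A : Type u} [Ring A] [Algebra k A] {x y : A}

lemma homProdOfEquiv_diff₁_comp (z : ModuleCat.of (EnvelopingAlgebra k A) (EnvelopingAlgebra k A) ⟶
    ModuleCat.of (EnvelopingAlgebra k A) A) :
    homProdOfEquiv k (ModuleCat.ofHom (diff₁ k x y) ≫ z) = codiff₀ k x y (homOfEquiv k z) := by
  have h1 : ∀ r : EnvelopingAlgebra k A, z.hom r = r • z.hom 1 := fun r => by
    rw [← map_smul, smul_eq_mul, mul_one]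
  refine Prod.ext ?_ ?_
  · change z.hom (diff₁ k x y (1, 0)) = (lm k x - rm k x) • z.hom 1
    rw [diff₁_apply, h1, one_mul, zero_mul, add_zero]
  · change z.hom (diff₁ k x y (0, 1)) = (lm k y - rm k y) • z.hom 1
    rw [diff₁_apply, h1, one_mul, zero_mul, zero_add]

lemma homOfEquiv_diff₂_comp
    (z : ModuleCat.of (EnvelopingAlgebra k A) (EnvelopingAlgebra k A × EnvelopingAlgebra k A) ⟶
      ModuleCat.of (EnvelopingAlgebra k A) A) :
    homOfEquiv k (ModuleCat.ofHom (diff₂ h x y) ≫ z) = codiff₁ h x y (homProdOfEquiv k z) := by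
  change z.hom (diff₂ h x y 1) = relX h x y • z.hom (1, 0) + relY k x • z.hom (0, 1)
  rw [diff₂_apply, ← map_smul, ← map_smul, ← map_add]
  simp

theorem hochschildCohomology [CharZero k] (hA : IsAhAlgebra h x y) (hh : h ≠ 0) :
    Nonempty (HochschildCohomology k A 0 ≃ₗ[k] k) ∧
    Nonempty (HochschildCohomology k A 1 ≃ₗ[k]
      (k[X] ⧸ Ideal.span {h}) × polynomialsIn k (idealI h)) ∧
    Nonempty (HochschildCohomology k A 2 ≃ₗ[k] (k[X] ⧸ Ideal.span {gcdDeriv h})[X]) ∧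
    ∀ i : ℕ, 3 ≤ i → Subsingleton (HochschildCohomology k A i) := by
  let X₀ := ModuleCat.of (EnvelopingAlgebra k A) (EnvelopingAlgebra k A)
  let X₁ := ModuleCat.of (EnvelopingAlgebra k A) (EnvelopingAlgebra k A × EnvelopingAlgebra k A)
  -- This is `regularBimodule k A` by unfolding, so the Ext lemmas apply directly.
  let Y := ModuleCat.of (EnvelopingAlgebra k A) A
  let d₁ : X₁ ⟶ X₀ := ModuleCat.ofHom (diff₁ k x y)
  let d₂ : X₀ ⟶ X₁ := ModuleCat.ofHom (diff₂ h x y)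
  let ε : X₀ ⟶ Y := ModuleCat.ofHom (augmentation k A)
  have : Projective X₀ := (IsProjective.iff_projective _).1 inferInstance
  have : Projective X₁ := (IsProjective.iff_projective _).1 inferInstance
  have : Mono d₂ := (ModuleCat.mono_iff_injective _).2 hA.diff₂_injective
  have : Epi ε := (ModuleCat.epi_iff_surjective _).2 augmentation_surjective
  have w : d₂ ≫ d₁ = 0 := ModuleCat.hom_ext hA.diff₁_comp_diff₂
  have w' : d₁ ≫ ε = 0 := ModuleCat.hom_ext augmentation_comp_diff₁
  have hex : (ShortComplex.mk d₂ d₁ w).Exact :=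
    ModuleCat.shortComplex_exact _ hA.exact_diff₂_diff₁
  have hex' : (ShortComplex.mk d₁ ε w').Exact :=
    ModuleCat.shortComplex_exact _ hA.exact_diff₁_augmentation
  refine ⟨?_, ?_, ?_, fun i hi => subsingleton_ext_of_three_le w ε w' hex hex' Y hi⟩
  · let φ : k →ₗ[k] LinearMap.ker (codiff₀ k x y) :=
      (Algebra.linearMap k A).codRestrict _ fun c => (hA.ker_codiff₀ hh _).2 ⟨c, rfl⟩
    have : Nontrivial A := hA.normal_injective.nontrivial
    have hφ : Function.Bijective φ := by
      refine ⟨fun a b hab => (algebraMap k A).injective (congrArg Subtype.val hab), ?_⟩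
      rintro ⟨a, ha⟩
      obtain ⟨c, rfl⟩ := (hA.ker_codiff₀ hh a).1 ha
      exact ⟨c, rfl⟩
    refine nonempty_ext_zero_linearEquiv w ε w' hex hex' Y (homOfEquiv k) _ (fun z => ?_)
      (LinearEquiv.ofBijective φ hφ).symm
    rw [LinearMap.mem_ker, ← homProdOfEquiv_diff₁_comp]
    exact LinearEquiv.map_eq_zero_iff _
  · obtain ⟨e⟩ := hA.nonempty_cohomology_one_linearEquiv hh
    have hN : ∀ z, homProdOfEquiv k z ∈ LinearMap.ker (codiff₁ h x y) ↔ d₂ ≫ z = 0 := fun z => by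
      rw [LinearMap.mem_ker, ← homOfEquiv_diff₂_comp]
      exact LinearEquiv.map_eq_zero_iff _
    refine nonempty_ext_one_linearEquiv w ε w' hex hex' Y (homProdOfEquiv k) _ hN
      (e.toLinearMap ∘ₗ Submodule.mkQ _) (e.surjective.comp (Submodule.mkQ_surjective _)) ?_
    intro z
    refine (LinearEquiv.map_eq_zero_iff e).trans ((Submodule.Quotient.mk_eq_zero _).trans ?_)
    constructor
    · rintro ⟨a, ha⟩
      refine ⟨(homOfEquiv k).symm a, ?_⟩
      rw [LinearEquiv.eq_symm_apply, homProdOfEquiv_diff₁_comp, LinearEquiv.apply_symm_apply]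
      exact ha
    · rintro ⟨z', hz'⟩
      refine ⟨homOfEquiv k z', ?_⟩
      rw [LinearEquiv.eq_symm_apply, homProdOfEquiv_diff₁_comp] at hz'
      exact hz'
  · refine nonempty_ext_two_linearEquiv w ε w' hex hex' Y (homOfEquiv k)
      (hA.reduction (gcdDeriv_dvd h)).toLinearMap (hA.reduction_surjective _) fun a => ?_
    refine (hA.range_codiff₁ a).trans ?_
    constructor
    · rintro ⟨u, hu⟩
      refine ⟨(homProdOfEquiv k).symm u, ?_⟩
      rw [LinearEquiv.eq_symm_apply, homOfEquiv_diff₂_comp, LinearEquiv.apply_symm_apply]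
      exact hu
    · rintro ⟨z', hz'⟩
      refine ⟨homProdOfEquiv k z', ?_⟩
      rw [LinearEquiv.eq_symm_apply, homOfEquiv_diff₂_comp] at hz'
      exact hz'

end IsAhAlgebra

theorem mainTheorem7 {k : Type u} [Field k] [CharZero k] (h : k[X]) (hh : h ≠ 0) :
    Nonempty (HochschildCohomology k (Ah h) 0 ≃ₗ[k] k) ∧
    Nonempty (HochschildCohomology k (Ah h) 1 ≃ₗ[k]
      (k[X] ⧸ Ideal.span {h}) × polynomialsIn k (idealI h)) ∧
    Nonempty (HochschildCohomology k (Ah h) 2 ≃ₗ[k] (k[X] ⧸ Ideal.span {gcdDeriv h})[X]) ∧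
    ∀ i : ℕ, 3 ≤ i → Subsingleton (HochschildCohomology k (Ah h) i) :=
  Ah.isAhAlgebra.hochschildCohomology hh
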